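/- Conventions. A \emph{CSP pattern} $\langle V,D,C\rangle$ has a finite variable set $V$, a finite domain $D$ and a set $C$ of constraint patterns $\langle\sigma,\rho\rangle$ with $\sigma\subseteq V$ and $\rho:D^\sigma\to\{T,F,U\}$, where $U<T$, $U<F$ and $T,F$ are incomparable. A \emph{binary CSP instance} is a pattern in which the value $U$ is never taken, every scope has one or two elements, every pair of distinct variables is the scope of a constraint (the complete relation if none is given explicitly), and no two constraints have the same scope. A pattern $\chi=\langle V_0,D_0,C_0\rangle$ whose variables are required to be distinct \emph{occurs} in $P=\langle V,D,C\rangle$ if there are an injective $s:V_0\to V$ and a map $t:V_0\times D_0\to D$ such that for each $\langle\sigma,\rho\rangle\in C_0$ the values of $\rho$ at any two labellings with the same image are comparable, and $C$ contains a constraint $\langle s(\sigma),\rho_1\rangle$ with $\rho_1(f)\ge\max\{\rho(\ell)\mid \ell\mapsto f\}$ for all $f:s(\sigma)\to D$ (the maximum over the empty set being $U$). The pattern \textsc{Negtrans} has three distinct variables $v,w,x$ with one value each; the pairs on $\{v,x\}$ and on $\{w,x\}$ have value $F$ and the pair on $\{v,w\}$ has value $T$. The \emph{inconsistency graph} $G_P$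 of a binary instance $P$ has as vertices the pairs $\langle v,a\rangle$ with $a$ allowed by the unary constraint on $v$ (any $a\in D$ if there is none), and $\langle v,a\rangle,\langle w,b\rangle$ with $v\ne w$ are adjacent iff the constraint on $\{v,w\}$ disallows $(a,b)$. A connected component $H$ of $G_P$ \emph{meets} $v$ if it contains some $\langle v,a\rangle$; it is an \emph{inconsistency clique} if any two of its vertices with distinct variables are adjacent. Theorem. Let $P=\langle V,D,C\rangle$ be a binary CSP instance in which \textsc{Negtrans} does not occur. (1) Each connected component of $G_P$ is an inconsistency clique or meets exactly two variables. (2) There is a maximal family $M$ of components of $G_P$ that are not inconsistency cliques and meet pairwise disjoint sets of variables. For every such $M$ let $V'$ be the set of variables met by no $H\in M$, let $P_{V'}$ be the subinstance of $P$ on $V'$ (the constraints with scope in $V'$), and let $P'$ be the instance of \textsc{AllDifferent}+\textsc{unary} with variable set $V'$ whose domain is the set of components of $G_{P_{V'}}$, with the unary constraint $v\in\{H\mid H\text{ meets }v\}$ for each $v\in V'$ and the constraint $v\neq w$ for each pair of distinct $v,w\in V'$. Then: (a) there is an assignment $f$ to $V\setminus V'$ such that, whenever $v\ne w$ are met by the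 same $H\in M$, $\langle v,f(v)\rangle$ and $\langle w,f(w)\rangle$ are non-adjacent vertices of $H$; and for every such $f$, an assignment $s:V\to D$ that extends $f$ is a solution of $P$ if and only if $s|_{V'}$ is a solution of $P_{V'}$; (b) the restriction to $V'$ of every solution of $P$ is a solution of $P_{V'}$; (c) all components of $G_{P_{V'}}$ are inconsistency cliques; (d) if $\langle v,s(v)\rangle\in s'(v)$ for all $v\in V'$, then $s$ is a solution of $P_{V'}$ if and only if $s'$ is a solution of $P'$; every solution $s$ of $P_{V'}$ has such an $s'$, and every solution $s'$ of $P'$ has such an $s$; (e) $P$ has a solution if and only if $P'$ has one, and this holds if and only if the bipartite graph that joins each $v\in V'$ to the components of $G_{P_{V'}}$ that meet $v$ has a matching covering $V'$. (3) The class of these instances is solvable in polynomial time, namely in time $O(n^3d^2)$, where $n=|V|$ and $d=|D|$: there are a random access machine program (unit cost per assignment, test, indirect read or write, addition and truncated subtraction; no multiplication) and a constant $c$ such that on every binary instance with $V=\{0,\dots,n-1\}$, $D=\{0,\dots,d-1\}$ in which \textsc{Negtrans} does not occur, given by $n$, $d$ and the tables of its unary and binary constraints, the program halts after at most $c\,(n^3d^2+1)$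 steps and either outputs a solution, or reports that there is none and there is indeed none. -/

import Mathlib

/-! ### Three-valued relations, patterns, instances, occurrence -/

/-- The three truth values: true, false, unknown. -/
inductive TruthVal
  | T
  | F
  | U

namespace TruthVal

/-- `U` lies below `T` and `F`, which are incomparable. -/
instance : PartialOrder TruthVal where
  le x y := x = U ∨ x = y
  le_refl _ := Or.inr rfl
  le_trans x y z h₁ h₂ := by
    rcases h₁ with h | h
    · exact Or.inl h
    · subst h; exact h₂
  le_antisymm x y h₁ h₂ := by
    rcases h₁ with h | h
    · rcases h₂ with h' | h'
      · rw [h, h']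
      · exact h'.symm
    · exact h

open Classical in
/-- The greatest element of a set of pairwise comparable truth values (`U` for the empty set). -/
noncomputable def greatest (S : Set TruthVal) : TruthVal :=
  if T ∈ S then T else if F ∈ S then F else U

open Classical in
/-- The truth value `T` or `F` of a proposition. -/
noncomputable def ofProp (p : Prop) : TruthVal := if p then T else F

end TruthVal

/-- A constraint pattern `⟨σ, ρ⟩` in functional representation: `ρ` assigns a truth value to
every domain labelling `σ → D` of the scope `σ`. -/
structure ConstraintPattern (V D : Type*) where
  scope : Set V
  rel : (scope → D) → TruthVal

/-- A CSP pattern with variable set `V` and domain `D`. The field `ctx` is the relational structure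
on `V × D` through which the pattern is considered in a context. -/
structure CSPPattern (V D : Type*) where
  ctx : V × D → V × D → Prop
  cons : Set (ConstraintPattern V D)

/-- `f` is the labelling of `s(σ)` induced by the labelling `ℓ` of the scope `σ` of `c`, where
variables are renamed by `s` and domain values by `t`. -/
def ConstraintPattern.IsImage {V D V' D' : Type*} (c : ConstraintPattern V D) (s : V → V')
    (t : V → D → D') (ℓ : c.scope → D) (f : (s '' c.scope : Set V') → D') : Prop :=
  ∀ v : c.scope, f ⟨s v, Set.mem_image_of_mem s v.2⟩ = t v (ℓ v)

/-- The constraint pattern `⟨s(σ), ρ'⟩` with `ρ'(f) = max {ρ(ℓ) | F(ℓ) = f}`. -/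
noncomputable def ConstraintPattern.rename {V D V' D' : Type*} (c : ConstraintPattern V D)
    (s : V → V') (t : V → D → D') : ConstraintPattern V' D' where
  scope := s '' c.scope
  rel f := TruthVal.greatest {τ | ∃ ℓ, c.IsImage s t ℓ f ∧ c.rel ℓ = τ}

namespace CSPPattern

/-- `χ'` is a renaming of `χ`. -/
def IsRenaming {V D V' D' : Type*} (χ : CSPPattern V D) (χ' : CSPPattern V' D') : Prop :=
  ∃ (s : V → V') (t : V → D → D'),
    (∀ v₁ v₂, v₁ ≠ v₂ → s v₁ = s v₂ →
      ¬ ∃ c ∈ χ.cons, v₁ ∈ c.scope ∧ v₂ ∈ c.scope ∧ ∃ ℓ, c.rel ℓ ≠ TruthVal.U) ∧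
    (∀ p q : V × D, χ.ctx p q → χ'.ctx (s p.1, t p.1 p.2) (s q.1, t q.1 q.2)) ∧
    (∀ c ∈ χ.cons, ∀ ℓ ℓ' : c.scope → D, (∀ v : c.scope, t v (ℓ v) = t v (ℓ' v)) →
      c.rel ℓ ≤ c.rel ℓ' ∨ c.rel ℓ' ≤ c.rel ℓ) ∧
    χ'.cons = {c' | ∃ c ∈ χ.cons, c' = c.rename s t}

/-- The pattern `χ` occurs in the pattern `P`. -/
def Occurs {V D V' D' : Type*} (χ : CSPPattern V D) (P : CSPPattern V' D') : Prop :=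
  ∃ χ' : CSPPattern V' D', χ'.ctx = P.ctx ∧ χ.IsRenaming χ' ∧
    ∀ c' ∈ χ'.cons, ∃ ρ : (c'.scope → D') → TruthVal,
      (⟨c'.scope, ρ⟩ : ConstraintPattern V' D') ∈ P.cons ∧ ∀ x, c'.rel x ≤ ρ x

/-- `P` is a binary CSP instance (in the flat context, whose structure is distinctness of
variables): no truth value is unknown, all scopes consist of one or two variables, every pair of
distinct variables is the scope of a constraint (a complete relation standing for the absence of
an explicit one), and no two constraints have the same scope. -/
structure IsBinaryInstance {V D : Type*} (P : CSPPattern V D) : Prop where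
  flat : ∀ p q, P.ctx p q ↔ p.1 ≠ q.1
  known : ∀ c ∈ P.cons, ∀ ℓ, c.rel ℓ ≠ TruthVal.U
  binary : ∀ c ∈ P.cons, ∃ u v, c.scope = {u, v}
  total : ∀ u v, u ≠ v → ∃ c ∈ P.cons, c.scope = {u, v}
  unique : ∀ c ∈ P.cons, ∀ c' ∈ P.cons, c.scope = c'.scope → c = c'

/-- `s` is a solution of `P`. -/
def IsSolution {V D : Type*} (P : CSPPattern V D) (s : V → D) : Prop :=
  ∀ c ∈ P.cons, c.rel (fun x => s x) = TruthVal.T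

/-- `P` has a solution. -/
def Solvable {V D : Type*} (P : CSPPattern V D) : Prop := ∃ s, P.IsSolution s

/-- The negative transitive pattern: three distinct variables `v = 0`, `w = 1`, `x = 2` with one
value each; the pairs on `{v, x}` and `{w, x}` are disallowed, the pair on `{v, w}` is allowed. -/
def negtrans : CSPPattern (Fin 3) Unit where
  ctx p q := p.1 ≠ q.1
  cons := {⟨{0, 2}, fun _ => TruthVal.F⟩, ⟨{1, 2}, fun _ => TruthVal.F⟩,
    ⟨{0, 1}, fun _ => TruthVal.T⟩}

/-- The class of binary CSP instances in which the negative transitive pattern does not occur. -/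
def NegtransFree {V D : Type*} (P : CSPPattern V D) : Prop :=
  P.IsBinaryInstance ∧ ¬ negtrans.Occurs P

/-! ### The inconsistency graph -/

/-- The value `a` is allowed by the unary constraint on `v` (if there is one). -/
def Permits {V D : Type*} (P : CSPPattern V D) (v : V) (a : D) : Prop :=
  ∀ c ∈ P.cons, c.scope = {v} → c.rel (fun _ => a) = TruthVal.T

/-- `v ≠ w`, and the constraint on `{v, w}` disallows the labelling `v ↦ a`, `w ↦ b`. -/
def Disallows {V D : Type*} (P : CSPPattern V D) (v : V) (a : D) (w : V) (b : D) : Prop :=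
  v ≠ w ∧ ∃ c ∈ P.cons, c.scope = {v, w} ∧
    ∃ ℓ : c.scope → D, (∀ x : c.scope, (x.1 = v → ℓ x = a) ∧ (x.1 = w → ℓ x = b)) ∧
      c.rel ℓ = TruthVal.F

theorem Disallows.symm {V D : Type*} {P : CSPPattern V D} {v : V} {a : D} {w : V} {b : D}
    (h : P.Disallows v a w b) : P.Disallows w b v a := by
  obtain ⟨hne, c, hc, hs, ℓ, hℓ, hF⟩ := h
  exact ⟨hne.symm, c, hc, hs.trans (Set.pair_comm v w), ℓ, fun x => (hℓ x).symm, hF⟩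

/-- The vertices `⟨v, a⟩` of the inconsistency graph. -/
abbrev Vertex {V D : Type*} (P : CSPPattern V D) : Type _ :=
  {p : V × D // P.Permits p.1 p.2}

/-- The inconsistency graph of `P`. -/
def incGraph {V D : Type*} (P : CSPPattern V D) : SimpleGraph P.Vertex where
  Adj p q := P.Disallows p.1.1 p.1.2 q.1.1 q.1.2
  symm := ⟨fun _ _ h => h.symm⟩
  loopless := ⟨fun _ h => h.1 rfl⟩

/-- The connected components of the inconsistency graph. -/
abbrev Component {V D : Type*} (P : CSPPattern V D) : Type _ :=
  P.incGraph.ConnectedComponent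

/-- The set of variables met by a component. -/
def vars {V D : Type*} {P : CSPPattern V D} (H : P.Component) : Set V :=
  {v | ∃ p ∈ H.supp, p.1.1 = v}

/-- `H` is an inconsistency clique: any two of its vertices with distinct variables are adjacent. -/
def IsInconsistencyClique {V D : Type*} {P : CSPPattern V D} (H : P.Component) : Prop :=
  ∀ p ∈ H.supp, ∀ q ∈ H.supp, p.1.1 ≠ q.1.1 → P.incGraph.Adj p q

/-! ### The reduction to AllDifferent with unary constraints -/

/-- The subinstance on the variables in `W`: a constraint belongs to it if it is, via the inclusion
of `W` in `V`, a constraint of `P`. -/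
def restrict {V D : Type*} (P : CSPPattern V D) (W : Set V) : CSPPattern W D where
  ctx p q := P.ctx (p.1, p.2) (q.1, q.2)
  cons := {c | (⟨Subtype.val '' c.scope,
    fun ℓ => c.rel fun x => ℓ ⟨x.1, Set.mem_image_of_mem _ x.2⟩⟩ : ConstraintPattern V D) ∈ P.cons}

/-- The instance with a unary constraint `v ∈ A v` on each variable and the constraint `v ≠ w` on
each pair of distinct variables. -/
noncomputable def allDifferentUnary {V D : Type*} (A : V → Set D) : CSPPattern V D where
  ctx p q := p.1 ≠ q.1
  cons :=
    {c | ∃ v, c = ⟨{v}, fun ℓ => TruthVal.ofProp (∀ x, ℓ x ∈ A x.1)⟩} ∪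
    {c | ∃ v w, v ≠ w ∧ c = ⟨{v, w}, fun ℓ => TruthVal.ofProp (Function.Injective ℓ)⟩}

/-- The bipartite graph in which each variable is joined to its allowed values. -/
def valueGraph {V D : Type*} (A : V → Set D) : SimpleGraph (V ⊕ D) :=
  SimpleGraph.fromRel fun x y => ∃ v a, x = Sum.inl v ∧ y = Sum.inr a ∧ a ∈ A v

/-- A maximal family of components that are not inconsistency cliques and meet pairwise disjoint
sets of variables: the components whose variables are successively assigned and removed. -/
structure IsRemovalFamily {V D : Type*} (P : CSPPattern V D) (M : Set P.Component) : Prop where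
  not_clique : ∀ H ∈ M, ¬ IsInconsistencyClique H
  disjoint : M.PairwiseDisjoint vars
  maximal : ∀ H : P.Component, ¬ IsInconsistencyClique H → ∃ K ∈ M, ¬ Disjoint (vars H) (vars K)

/-- The variables that remain after the variables met by the components in `M` are removed. -/
def remaining {V D : Type*} (P : CSPPattern V D) (M : Set P.Component) : Set V :=
  {v | ∀ H ∈ M, v ∉ vars H}

/-- `f` assigns to the removed variables values such that, for distinct variables `v, w` met by the
same `H ∈ M`, `⟨v, f v⟩` and `⟨w, f w⟩` are non-adjacent vertices of `H`. -/
def IsRemovalAssignment {V D : Type*} (P : CSPPattern V D) (M : Set P.Component)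
    (f : {v // v ∉ P.remaining M} → D) : Prop :=
  ∀ H ∈ M, ∀ v w : {v // v ∉ P.remaining M}, v.1 ∈ vars H → w.1 ∈ vars H → v ≠ w →
    ∃ p ∈ H.supp, ∃ q ∈ H.supp, p.1 = (v.1, f v) ∧ q.1 = (w.1, f w) ∧ ¬ P.incGraph.Adj p q

/-- For each variable of `P`, the components that contain one of its values. -/
def componentsAt {V D : Type*} (P : CSPPattern V D) (v : V) : Set P.Component :=
  {H | v ∈ vars H}

/-- `s'` assigns to each variable `v` the component that contains `⟨v, s v⟩`. -/
def Corresponds {V D : Type*} (P : CSPPattern V D) (s : V → D) (s' : V → P.Component) : Prop :=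
  ∀ v, ∃ p ∈ (s' v).supp, p.1 = (v, s v)

end CSPPattern

/-! ### Random access machine -/

namespace RAM

/-- Expressions over integer registers and arrays; `arr k e` reads cell `e` of array `k`. -/
inductive Expr
  | lit (k : ℕ)
  | reg (i : ℕ)
  | arr (k : ℕ) (e : Expr)
  | add (e₁ e₂ : Expr)
  | sub (e₁ e₂ : Expr)

/-- Structured programs of the machine. -/
inductive Prog
  | skip
  | assign (i : ℕ) (e : Expr)
  | store (k : ℕ) (e₁ e₂ : Expr)
  | seq (p q : Prog)
  | ite (e : Expr) (p q : Prog)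
  | loop (e : Expr) (p : Prog)

/-- The memory: registers, and arrays of unbounded length. A program names finitely many of them;
array cells are addressed indirectly. -/
structure Mem where
  reg : ℕ → ℕ
  arr : ℕ → ℕ → ℕ

/-- The value of an expression. Subtraction is truncated at `0`. There is no unit-cost
multiplication. -/
def Expr.val (m : Mem) : Expr → ℕ
  | lit k => k
  | reg i => m.reg i
  | arr k e => m.arr k (e.val m)
  | add e₁ e₂ => e₁.val m + e₂.val m
  | sub e₁ e₂ => e₁.val m - e₂.val m

/-- The number of elementary operations needed to evaluate an expression. -/
def Expr.cost : Expr → ℕ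
  | lit _ => 1
  | reg _ => 1
  | arr _ e => e.cost + 1
  | add e₁ e₂ => e₁.cost + e₂.cost + 1
  | sub e₁ e₂ => e₁.cost + e₂.cost + 1

/-- `Exec p m t m'`: started in the memory `m`, the program `p` halts after exactly `t` steps in the
memory `m'`. Tests in `ite` and `loop` ask whether the value of the expression is non-zero. -/
inductive Exec : Prog → Mem → ℕ → Mem → Prop
  | skip (m : Mem) : Exec .skip m 1 m
  | assign (m : Mem) (i : ℕ) (e : Expr) :
      Exec (.assign i e) m (e.cost + 1) ⟨Function.update m.reg i (e.val m), m.arr⟩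
  | store (m : Mem) (k : ℕ) (e₁ e₂ : Expr) :
      Exec (.store k e₁ e₂) m (e₁.cost + e₂.cost + 1)
        ⟨m.reg, Function.update m.arr k (Function.update (m.arr k) (e₁.val m) (e₂.val m))⟩
  | seq {p q : Prog} {m m₁ m₂ : Mem} {t₁ t₂ : ℕ} :
      Exec p m t₁ m₁ → Exec q m₁ t₂ m₂ → Exec (.seq p q) m (t₁ + t₂) m₂
  | ite_true {e : Expr} {p q : Prog} {m m' : Mem} {t : ℕ} :
      e.val m ≠ 0 → Exec p m t m' → Exec (.ite e p q) m (e.cost + 1 + t) m'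
  | ite_false {e : Expr} {p q : Prog} {m m' : Mem} {t : ℕ} :
      e.val m = 0 → Exec q m t m' → Exec (.ite e p q) m (e.cost + 1 + t) m'
  | loop_exit {e : Expr} {p : Prog} {m : Mem} :
      e.val m = 0 → Exec (.loop e p) m (e.cost + 1) m
  | loop_step {e : Expr} {p : Prog} {m m₁ m₂ : Mem} {t₁ t₂ : ℕ} :
      e.val m ≠ 0 → Exec p m t₁ m₁ → Exec (.loop e p) m₁ t₂ m₂ →
        Exec (.loop e p) m (e.cost + 1 + t₁ + t₂) m₂

open Classical in
/-- The initial memory for an instance with variables `0, …, n - 1` and values `0, …, d - 1`: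
registers `0` and `1` hold `n` and `d`, array `0` is the table of the unary constraints
(`1` for allowed), array `1` the table of the binary constraints (`1` for disallowed), everything
else is `0`. -/
noncomputable def input {n d : ℕ} (P : CSPPattern (Fin n) (Fin d)) : Mem where
  reg i := if i = 0 then n else if i = 1 then d else 0
  arr k i :=
    if (k = 0 ∧ ∃ v a, i = v.1 * d + a.1 ∧ P.Permits v a) ∨
        (k = 1 ∧ ∃ v a w b, i = (v.1 * d + a.1) * (n * d) + (w.1 * d + b.1) ∧
          P.Disallows v a w b)
      then 1 else 0

/-- The final memory answers the instance `P`: either register `0` holds `1` and array `2` lists the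
values of a solution, or register `0` holds `0` and there is no solution. -/
def Answers {n d : ℕ} (P : CSPPattern (Fin n) (Fin d)) (m : Mem) : Prop :=
  (m.reg 0 = 1 ∧ ∃ s, P.IsSolution s ∧ ∀ v : Fin n, m.arr 2 v.1 = (s v).1) ∨
    (m.reg 0 = 0 ∧ ¬ P.Solvable)

end RAM

/-! ### The inconsistency graph and the reduction to a matching problem. -/

namespace CSPPattern

universe u₁ u₂
variable {V : Type u₁} {D : Type u₂} {P : CSPPattern V D}

/-! ### Solutions and negative transitivity -/

/-! Absence of `negtrans` forces two vertices of the inconsistency graph with a common neighbour and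
different variables to be adjacent (`NegtransFree.disallows`). Call a vertex branching if its
neighbours lie in at least two variables. Branching spreads along edges, and a vertex reachable from
a branching one is adjacent to it as soon as the variables differ (`Branching.adj_of_reachable`).
Without branching vertices, every walk alternates between two variables (`var_of_not_branching`).
Hence a component that is not an inconsistency clique lives on exactly two variables
(`vars_eq_pair`).

Two non-adjacent vertices of such a component can be assigned at no cost: all their neighbours stay
in the component, hence in these two variables (`IsRemovalAssignment.isSolution_iff`). Once a
maximal disjoint family is removed, only cliques remain (`IsRemovalFamily.isInconsistencyClique`).
There two values of different variables are compatible iff they lie in different components, so that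
a solution is an injective choice of components, that is, a matching.

The machine never computes components. It assigns, greedily, non-adjacent values of two variables
that have no neighbours outside these variables; with n² pairs of variables and about nd² steps for
each, this is the n³d² term. Afterwards paths of length three between two unassigned variables close
up (`Net.PairInv.quad`), which stands in for the clique property. The remaining variables are
assigned by augmenting paths, in n searches of about n²d steps (`search_runs`). A failed search
exhibits a violation of Hall's condition: the values of the queued variables lie in cliques that are
occupied by queued variables other than the unassigned root, one fewer than the variables themselves
(`Net.SearchInv.unsolvable`). -/

theorem isSolution_iff (hk : ∀ c ∈ P.cons, ∀ ℓ, c.rel ℓ ≠ TruthVal.U)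
    (hb : ∀ c ∈ P.cons, ∃ u v, c.scope = {u, v}) (s : V → D) :
    P.IsSolution s ↔ (∀ v, P.Permits v (s v)) ∧ ∀ v w, ¬ P.Disallows v (s v) w (s w) := by
  constructor
  · intro h
    refine ⟨fun v c hc hs => ?_, ?_⟩
    · rw [← h c hc]
      congr 1
      funext x
      have : x.1 = v := hs.subset x.2
      rw [this]
    · rintro v w ⟨-, c, hc, hs, ℓ, hℓ, hF⟩
      have : ℓ = fun x => s x.1 := by
        funext x
        rcases hs.subset x.2 with hx | hx
        · rw [(hℓ x).1 hx, hx]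
        · rw [(hℓ x).2 hx, hx]
      rw [this, h c hc] at hF
      cases hF
  · rintro ⟨h1, h2⟩ c hc
    obtain ⟨u, v, hs⟩ := hb c hc
    by_cases huv : u = v
    · subst huv
      rw [Set.pair_eq_singleton] at hs
      rw [← h1 u c hc hs]
      congr 1
      funext x
      have : x.1 = u := hs.subset x.2
      rw [this]
    · cases hr : c.rel (fun x => s x) with
      | T => rfl
      | U => exact absurd hr (hk c hc _)
      | F =>
        refine absurd ?_ (h2 u v)
        exact ⟨huv, c, hc, hs, _, fun x => ⟨fun hx => by rw [hx], fun hx => by rw [hx]⟩, hr⟩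

/-- As `s` is injective and there is one value per variable, the renamed relation is `τ` on the
single image labelling and `U` elsewhere; only the former constrains `c`. -/
theorem exists_rename_le {χ : ConstraintPattern (Fin 3) Unit} {s : Fin 3 → V} {t : Fin 3 → D}
    (hinj : Function.Injective s) {τ : TruthVal} (hχ : ∀ ℓ, χ.rel ℓ = τ)
    {c : ConstraintPattern V D} (hc : c ∈ P.cons) (hs : c.scope = s '' χ.scope)
    (hrel : ∀ ℓ : c.scope → D, (∀ (y : c.scope) i, y.1 = s i → ℓ y = t i) → c.rel ℓ = τ) :
    ∃ ρ : ((χ.rename s fun i _ => t i).scope → D) → TruthVal,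
      (⟨(χ.rename s fun i _ => t i).scope, ρ⟩ : ConstraintPattern V D) ∈ P.cons ∧
        ∀ x, (χ.rename s fun i _ => t i).rel x ≤ ρ x := by
  obtain ⟨σ, r⟩ := c
  simp only at hs
  subst hs
  refine ⟨r, hc, fun f => ?_⟩
  by_cases hf : ∃ ℓ, χ.IsImage s (fun i _ => t i) ℓ f
  · obtain ⟨ℓ, hℓ⟩ := hf
    have hr : r f = τ := by
      refine hrel f fun y i hy => ?_
      obtain ⟨j, hj, hjy⟩ := y.2
      have : j = i := hinj (hjy.trans hy)
      subst this
      exact (congrArg f (Subtype.ext hy)).trans (hℓ ⟨j, hj⟩)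
    have hset : {τ' | ∃ ℓ, χ.IsImage s (fun i _ => t i) ℓ f ∧ χ.rel ℓ = τ'} = {τ} := by
      ext τ'
      constructor
      · rintro ⟨ℓ', -, h⟩
        rw [← h, hχ]; rfl
      · rintro rfl
        exact ⟨ℓ, hℓ, hχ ℓ⟩
    refine Or.inr ?_
    change TruthVal.greatest {τ' | ∃ ℓ, χ.IsImage s (fun i _ => t i) ℓ f ∧ χ.rel ℓ = τ'} = r f
    rw [hset, hr]
    cases τ <;> simp [TruthVal.greatest]
  · left
    have hset : {τ' | ∃ ℓ, χ.IsImage s (fun i _ => t i) ℓ f ∧ χ.rel ℓ = τ'} = ∅ := by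
      ext τ'
      simp only [Set.mem_ofPred_eq, Set.mem_empty_iff_false, iff_false]
      rintro ⟨ℓ, h, -⟩
      exact hf ⟨ℓ, h⟩
    change TruthVal.greatest {τ' | ∃ ℓ, χ.IsImage s (fun i _ => t i) ℓ f ∧ χ.rel ℓ = τ'} = _
    rw [hset]
    simp [TruthVal.greatest]

/-- Instances without the negative transitive pattern are negatively transitive. -/
theorem NegtransFree.disallows (h : P.NegtransFree) {v w x : V} {a b c : D}
    (h₁ : P.Disallows v a x c) (h₂ : P.Disallows w b x c) (hvw : v ≠ w) : P.Disallows v a w b := by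
  by_contra hcon
  obtain ⟨hI, hocc⟩ := h
  refine hocc ?_
  have hvx := h₁.1
  have hwx := h₂.1
  let s : Fin 3 → V := ![v, w, x]
  let t : Fin 3 → D := ![a, b, c]
  have hinj : Function.Injective s := by
    intro i j hij
    fin_cases i <;> fin_cases j <;> simp [s] at hij ⊢ <;>
      first | exact hvw hij | exact hvw hij.symm | exact hvx hij | exact hvx hij.symm |
        exact hwx hij | exact hwx hij.symm
  have image_pair : ∀ i j, s '' ({i, j} : Set (Fin 3)) = {s i, s j} := fun i j => by
    rw [Set.image_pair]
  have fromDisallows : ∀ i j : Fin 3, P.Disallows (s i) (t i) (s j) (t j) →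
      ∃ c ∈ P.cons, c.scope = {s i, s j} ∧
        ∀ ℓ : c.scope → D, (∀ (y : c.scope) k, y.1 = s k → ℓ y = t k) → c.rel ℓ = TruthVal.F := by
    rintro i j ⟨-, c, hc, hs, ℓ, hℓ, hF⟩
    refine ⟨c, hc, hs, fun ℓ' hℓ' => ?_⟩
    rw [← hF]
    congr 1
    funext y
    rcases hs.subset y.2 with hy | hy
    · rw [(hℓ y).1 hy, hℓ' y i hy]
    · rw [(hℓ y).2 hy, hℓ' y j hy]
  refine ⟨⟨P.ctx, {c' | ∃ c ∈ negtrans.cons, c' = c.rename s fun i _ => t i}⟩, rfl,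
    ⟨s, fun i _ => t i, ?_, ?_, ?_, rfl⟩, ?_⟩
  · intro i j hij he
    exact absurd (hinj he) hij
  · intro p q hpq
    exact (hI.flat _ _).2 fun he => hpq (hinj he)
  · intro c _ ℓ ℓ' _
    have : ℓ = ℓ' := Subsingleton.elim _ _
    rw [this]
    exact Or.inl le_rfl
  · rintro _ ⟨χ, hχ, rfl⟩
    rcases hχ with rfl | rfl | rfl
    · obtain ⟨c, hc, hs, hr⟩ := fromDisallows 0 2 h₁
      exact exists_rename_le hinj (fun _ => rfl) hc (hs.trans (image_pair 0 2).symm) hr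
    · obtain ⟨c, hc, hs, hr⟩ := fromDisallows 1 2 h₂
      exact exists_rename_le hinj (fun _ => rfl) hc (hs.trans (image_pair 1 2).symm) hr
    -- A binary instance has an explicit constraint on every pair and never takes the value `U`, so
    -- a pair that is not disallowed has value `T`.
    · obtain ⟨c, hc, hs⟩ := hI.total v w hvw
      refine exists_rename_le hinj (fun _ => rfl) hc (hs.trans (image_pair 0 1).symm)
        fun ℓ hℓ => ?_
      cases hr : c.rel ℓ with
      | T => rfl
      | U => exact absurd hr (hI.known c hc _)
      | F => exact absurd ⟨hvw, c, hc, hs, ℓ, fun y => ⟨hℓ y 0, hℓ y 1⟩, hr⟩ hcon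

/-! ### Components of negatively transitive graphs -/

section Graph

variable {X : Type*} {G : SimpleGraph X} {var : X → V}

/-- The vertex `p` has neighbours in two different classes. -/
def Branching (G : SimpleGraph X) (var : X → V) (p : X) : Prop :=
  ∃ y z, G.Adj p y ∧ G.Adj p z ∧ var y ≠ var z

/-- Besides `x`, the vertex `u` has as neighbour whichever of the two neighbours of `x` lies outside
the class of `u`, by transitivity through `x`. -/
theorem Branching.of_adj (hne : ∀ {p q}, G.Adj p q → var p ≠ var q)
    (htr : ∀ {p q x}, G.Adj p x → G.Adj q x → var p ≠ var q → G.Adj p q) {u x : X}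
    (h : Branching G var x) (hux : G.Adj u x) : Branching G var u := by
  obtain ⟨y, z, hy, hz, hyz⟩ := h
  by_cases huy : var u = var y
  · have : var u ≠ var z := huy ▸ hyz
    exact ⟨x, z, hux, htr hux hz.symm this, hne hz⟩
  · exact ⟨x, y, hux, htr hux hy.symm huy, hne hy⟩

theorem Branching.of_reachable (hne : ∀ {p q}, G.Adj p q → var p ≠ var q)
    (htr : ∀ {p q x}, G.Adj p x → G.Adj q x → var p ≠ var q → G.Adj p q) {u x : X}
    (h : Branching G var x) (hux : G.Reachable u x) : Branching G var u := by
  rw [SimpleGraph.reachable_iff_reflTransGen] at hux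
  induction hux using Relation.ReflTransGen.head_induction_on with
  | refl => exact h
  | head hab _ ih => exact ih.of_adj hne htr hab

/-- Induction along a path works only for a stronger claim: vertices in the class of `p` must be
known to be twins of `p`, with the same neighbours. -/
theorem Branching.adj_of_reachable (hne : ∀ {p q}, G.Adj p q → var p ≠ var q)
    (htr : ∀ {p q x}, G.Adj p x → G.Adj q x → var p ≠ var q → G.Adj p q) {p q : X}
    (hp : Branching G var p) (hpq : G.Reachable p q) (hv : var p ≠ var q) : G.Adj p q := by
  have key : (var p ≠ var q → G.Adj p q) ∧
      (var p = var q → ∀ z, G.Adj p z → G.Adj q z) ∧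
      (var p = var q → ∀ z, G.Adj q z → G.Adj p z) := by
    rw [SimpleGraph.reachable_iff_reflTransGen] at hpq
    clear hv
    induction hpq with
    | refl => exact ⟨fun h => absurd rfl h, fun _ _ h => h, fun _ _ h => h⟩
    | @tail x y hpx hxy ih =>
      have hpy : G.Reachable p y := by
        rw [SimpleGraph.reachable_iff_reflTransGen]
        exact hpx.tail hxy
      have hy : Branching G var y := hp.of_reachable hne htr hpy.symm
      -- Vertices of one class with a common neighbour `x` are twins. A neighbour outside the class
      -- of `x` is transferred through `x`; one inside it through a second neighbour `r` in another
      -- class, which exists by branching.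
      have half : ∀ {p y : X}, Branching G var p → var p = var y → G.Adj p x → G.Adj y x →
          ∀ z, G.Adj p z → G.Adj y z := by
        intro p y hp hv hpx hyx
        have first : ∀ z, G.Adj p z → var z ≠ var x → G.Adj y z := fun z hz hzx =>
          htr hyx (htr hz.symm hpx.symm hzx) (hv ▸ hne hz)
        intro z hz
        by_cases hzx : var z = var x
        · obtain ⟨r₁, r₂, hr₁, hr₂, hr⟩ := hp
          obtain ⟨r, hr, hrx⟩ : ∃ r, G.Adj p r ∧ var r ≠ var x := by
            by_cases h : var r₁ = var x
            · exact ⟨r₂, hr₂, fun h' => hr (h.trans h'.symm)⟩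
            · exact ⟨r₁, hr₁, h⟩
          have hyr := first r hr hrx
          have hrz : G.Adj z r := htr hz.symm hr.symm (hzx ▸ hrx.symm)
          exact htr hyr hrz (hv ▸ hne hz)
        · exact first z hz hzx
      by_cases hx : var p = var x
      · have hadj : G.Adj p y := ih.2.2 hx y hxy
        exact ⟨fun _ => hadj, fun h => absurd h (hne hadj), fun h => absurd h (hne hadj)⟩
      · have hadj : G.Adj p x := ih.1 hx
        refine ⟨fun h => htr hadj hxy.symm h, fun h => ?_, fun h => ?_⟩
        · exact half hp h hadj hxy.symm
        · exact half hy h.symm hxy.symm hadj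
  exact key.1 hv

/-- No vertex of the component is branching, so all neighbours of a vertex share the class of the
vertex from which the walk arrived, and the walk alternates. -/
theorem var_of_not_branching (hne : ∀ {p q}, G.Adj p q → var p ≠ var q)
    (htr : ∀ {p q x}, G.Adj p x → G.Adj q x → var p ≠ var q → G.Adj p q) {p r x : X}
    (hp : ¬ Branching G var p) (hpr : G.Adj p r) (hpx : G.Reachable p x) :
    var x = var p ∨ var x = var r := by
  have nb : ∀ {y z z' : X}, G.Reachable p y → G.Adj y z → G.Adj y z' → var z = var z' := by
    intro y z z' hy hz hz'
    by_contra h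
    exact hp (Branching.of_reachable hne htr ⟨z, z', hz, hz', h⟩ hy)
  have key : (var x = var p ∧ ∀ z, G.Adj x z → var z = var r) ∨
      (var x = var r ∧ ∀ z, G.Adj x z → var z = var p) := by
    rw [SimpleGraph.reachable_iff_reflTransGen] at hpx
    induction hpx with
    | refl => exact Or.inl ⟨rfl, fun z hz => nb (SimpleGraph.Reachable.refl p) hz hpr⟩
    | @tail x y hpx hxy ih =>
      have hpy : G.Reachable p y := by
        rw [SimpleGraph.reachable_iff_reflTransGen]
        exact hpx.tail hxy
      rcases ih with ⟨h1, h2⟩ | ⟨h1, h2⟩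
      · exact Or.inr ⟨h2 y hxy, fun z hz => (nb hpy hz hxy.symm).trans h1⟩
      · exact Or.inl ⟨h2 y hxy, fun z hz => (nb hpy hz hxy.symm).trans h1⟩
  exact key.imp And.left And.left

end Graph

theorem adj_of_adj_adj (h : P.NegtransFree) {p q x : P.Vertex} (h₁ : P.incGraph.Adj p x)
    (h₂ : P.incGraph.Adj q x) (hne : p.1.1 ≠ q.1.1) : P.incGraph.Adj p q :=
  NegtransFree.disallows h h₁ h₂ hne

theorem var_ne_of_adj {p q : P.Vertex} (h : P.incGraph.Adj p q) : p.1.1 ≠ q.1.1 := h.1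

theorem reachable_of_mem {H : P.Component} {p q : P.Vertex} (hp : p ∈ H.supp) (hq : q ∈ H.supp) :
    P.incGraph.Reachable p q :=
  SimpleGraph.ConnectedComponent.exact
    ((SimpleGraph.ConnectedComponent.mem_supp_iff _ _).1 hp |>.trans
      ((SimpleGraph.ConnectedComponent.mem_supp_iff _ _).1 hq).symm)

theorem mem_of_reachable {H : P.Component} {p q : P.Vertex} (hp : p ∈ H.supp)
    (h : P.incGraph.Reachable p q) : q ∈ H.supp := by
  rw [SimpleGraph.ConnectedComponent.mem_supp_iff] at hp ⊢
  rw [← hp]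
  exact SimpleGraph.ConnectedComponent.sound h.symm

/-- A component with non-adjacent vertices `p, q` of different variables meets no others. -/
theorem vars_eq_pair (h : P.NegtransFree) {H : P.Component} {p q : P.Vertex} (hp : p ∈ H.supp)
    (hq : q ∈ H.supp) (hne : p.1.1 ≠ q.1.1) (hadj : ¬ P.incGraph.Adj p q) :
    vars H = {p.1.1, q.1.1} := by
  have hpq := reachable_of_mem hp hq
  have hnb : ¬ Branching P.incGraph (fun x : P.Vertex => x.1.1) p := fun hb =>
    hadj (hb.adj_of_reachable var_ne_of_adj (adj_of_adj_adj h) hpq hne)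
  obtain ⟨r, hr⟩ : ∃ r, P.incGraph.Adj p r := by
    have h' := hpq
    rw [SimpleGraph.reachable_iff_reflTransGen] at h'
    rcases Relation.ReflTransGen.cases_head h' with rfl | ⟨r, hr, -⟩
    · exact absurd rfl hne
    · exact ⟨r, hr⟩
  have two : ∀ {x}, P.incGraph.Reachable p x → x.1.1 = p.1.1 ∨ x.1.1 = r.1.1 := fun hx =>
    var_of_not_branching (var := fun x : P.Vertex => x.1.1) var_ne_of_adj (adj_of_adj_adj h)
      hnb hr hx
  have hqr : q.1.1 = r.1.1 := (two hpq).resolve_left hne.symm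
  ext v
  constructor
  · rintro ⟨x, hx, rfl⟩
    rw [hqr]
    exact two (reachable_of_mem hp hx)
  · rintro (rfl | rfl)
    · exact ⟨p, hp, rfl⟩
    · exact ⟨q, hq, rfl⟩

theorem exists_not_adj {H : P.Component} (h : ¬ IsInconsistencyClique H) :
    ∃ p ∈ H.supp, ∃ q ∈ H.supp, p.1.1 ≠ q.1.1 ∧ ¬ P.incGraph.Adj p q := by
  unfold IsInconsistencyClique at h
  push Not at h
  exact h

theorem clique_or_ncard_vars (h : P.NegtransFree) (H : P.Component) :
    IsInconsistencyClique H ∨ (vars H).ncard = 2 := by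
  by_cases hc : IsInconsistencyClique H
  · exact Or.inl hc
  · obtain ⟨p, hp, q, hq, hne, hadj⟩ := exists_not_adj hc
    right
    rw [vars_eq_pair h hp hq hne hadj, Set.ncard_pair hne]

theorem vars_nonempty (H : P.Component) : (vars H).Nonempty := by
  obtain ⟨p, hp⟩ := H.nonempty_supp
  exact ⟨_, p, hp, rfl⟩

theorem exists_removalFamily [Finite V] [Finite D] (P : CSPPattern V D) :
    ∃ M, P.IsRemovalFamily M := by
  have : Finite P.Component := Quot.finite _
  obtain ⟨M, hM⟩ := (Set.toFinite {M : Set P.Component |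
    (∀ H ∈ M, ¬ IsInconsistencyClique H) ∧ M.PairwiseDisjoint vars}).exists_maximal
    ⟨∅, by simp, Set.pairwiseDisjoint_empty⟩
  refine ⟨M, hM.prop.1, hM.prop.2, fun H hH => ?_⟩
  by_contra hcon
  push Not at hcon
  have hmem : H ∈ M := by
    refine hM.le_of_ge (y := insert H M) ⟨?_, ?_⟩ (Set.subset_insert H M) (Set.mem_insert H M)
    · rintro K (rfl | hK)
      · exact hH
      · exact hM.prop.1 K hK
    · exact hM.prop.2.insert fun K hK _ => hcon K hK
  -- With `H` in `M`, the negated claim makes `vars H` disjoint from itself.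
  exact (vars_nonempty H).ne_empty (disjoint_self.1 (hcon H hmem))

/-! ### Subinstances -/

/-- A constraint on variables in `W`, as a constraint on all variables. -/
def extend {W : Set V} (c : ConstraintPattern W D) : ConstraintPattern V D :=
  ⟨Subtype.val '' c.scope, fun ℓ => c.rel fun x => ℓ ⟨x.1, Set.mem_image_of_mem _ x.2⟩⟩

/-- Membership in `restrict` is tested on extensions, so using a constraint of `P` in the
subinstance requires a preimage under `extend`. -/
theorem exists_extend_eq {W : Set V} {c : ConstraintPattern V D} {σ : Set W}
    (hs : c.scope = Subtype.val '' σ) :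
    ∃ c' : ConstraintPattern W D, c'.scope = σ ∧ extend c' = c := by
  obtain ⟨sc, r⟩ := c
  simp only at hs
  subst hs
  have hW : ∀ x : (Subtype.val '' σ : Set V), x.1 ∈ W := by
    rintro ⟨_, y, _, rfl⟩; exact y.2
  have hσ : ∀ x : (Subtype.val '' σ : Set V), (⟨x.1, hW x⟩ : W) ∈ σ := by
    rintro ⟨_, y, hy, rfl⟩; exact hy
  exact ⟨⟨σ, fun ℓ => r fun x => ℓ ⟨⟨x.1, hW x⟩, hσ x⟩⟩, rfl, rfl⟩

theorem exists_labelling {W : Set V} {σ : Set W} (ℓ : σ → D) :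
    ∃ ℓ' : (Subtype.val '' σ : Set V) → D,
      ∀ x : σ, ℓ' ⟨x.1.1, Set.mem_image_of_mem _ x.2⟩ = ℓ x := by
  have hW : ∀ x : (Subtype.val '' σ : Set V), x.1 ∈ W := by
    rintro ⟨_, y, _, rfl⟩; exact y.2
  have hσ : ∀ x : (Subtype.val '' σ : Set V), (⟨x.1, hW x⟩ : W) ∈ σ := by
    rintro ⟨_, y, hy, rfl⟩; exact hy
  exact ⟨fun x => ℓ ⟨⟨x.1, hW x⟩, hσ x⟩, fun x => rfl⟩

theorem restrict_permits {W : Set V} {v : W} {a : D} :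
    (P.restrict W).Permits v a ↔ P.Permits v.1 a := by
  constructor
  · intro h c hc hs
    obtain ⟨c', hs', rfl⟩ := exists_extend_eq (W := W) (σ := {v})
      (hs.trans Set.image_singleton.symm)
    exact h c' hc hs'
  · intro h c hc hs
    refine h (extend c) hc ?_
    simp [extend, hs]

theorem restrict_disallows {W : Set V} {v w : W} {a b : D} :
    (P.restrict W).Disallows v a w b ↔ P.Disallows v.1 a w.1 b := by
  constructor
  · rintro ⟨hne, c, hc, hs, ℓ, hℓ, hF⟩
    obtain ⟨ℓ', hℓ'⟩ := exists_labelling ℓ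
    refine ⟨fun h => hne (Subtype.ext h), extend c, hc, ?_, ℓ', ?_, ?_⟩
    · simp only [extend, hs, Set.image_pair]
    · rintro ⟨_, y, hy, rfl⟩
      have := hℓ' ⟨y, hy⟩
      exact ⟨fun h => this.trans ((hℓ ⟨y, hy⟩).1 (Subtype.ext h)),
        fun h => this.trans ((hℓ ⟨y, hy⟩).2 (Subtype.ext h))⟩
    · rw [← hF]
      change c.rel _ = c.rel _
      congr 1
      funext x
      exact hℓ' x
  · rintro ⟨hne, c, hc, hs, ℓ, hℓ, hF⟩
    obtain ⟨c', hs', rfl⟩ := exists_extend_eq (W := W) (σ := {v, w})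
      (hs.trans (Set.image_pair _ _ _).symm)
    refine ⟨fun h => hne (congrArg _ h), c', hc, hs',
      fun x => ℓ ⟨x.1, Set.mem_image_of_mem _ x.2⟩, fun x => ?_, hF⟩
    have := hℓ ⟨x.1, Set.mem_image_of_mem _ x.2⟩
    exact ⟨fun h => this.1 (congrArg Subtype.val h), fun h => this.2 (congrArg Subtype.val h)⟩

theorem restrict_known (h : P.IsBinaryInstance) (W : Set V) :
    ∀ c ∈ (P.restrict W).cons, ∀ ℓ, c.rel ℓ ≠ TruthVal.U := by
  intro c hc ℓ hU
  obtain ⟨ℓ', hℓ'⟩ := exists_labelling ℓ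
  refine h.known (extend c) hc ℓ' ?_
  rw [← hU]
  change c.rel _ = c.rel _
  congr 1
  funext x
  exact hℓ' x

theorem restrict_binary (h : P.IsBinaryInstance) (W : Set V) :
    ∀ c ∈ (P.restrict W).cons, ∃ u v, c.scope = {u, v} := by
  intro c hc
  obtain ⟨u, v, hs⟩ := h.binary (extend c) hc
  have hs' : Subtype.val '' c.scope = ({u, v} : Set V) := hs
  obtain ⟨u', hu', rfl⟩ : u ∈ Subtype.val '' c.scope := by rw [hs']; simp
  obtain ⟨v', hv', rfl⟩ : v ∈ Subtype.val '' c.scope := by rw [hs']; simp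
  refine ⟨u', v', Subtype.val_injective.image_injective ?_⟩
  rw [hs', Set.image_pair]

/-- Known values and binary scopes are all that `isSolution_iff` asks for, so the subinstance need
not be shown to be a binary instance in full. -/
theorem restrict_isSolution_iff (h : P.IsBinaryInstance) (W : Set V) (s : W → D) :
    (P.restrict W).IsSolution s ↔
      (∀ v, P.Permits v.1 (s v)) ∧ ∀ v w, ¬ P.Disallows v.1 (s v) w.1 (s w) := by
  rw [isSolution_iff (restrict_known h W) (restrict_binary h W)]
  simp only [restrict_permits, restrict_disallows]

/-! ### AllDifferent with unary constraints -/

theorem ofProp_eq_T {p : Prop} : TruthVal.ofProp p = TruthVal.T ↔ p := by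
  unfold TruthVal.ofProp
  split_ifs with h <;> simp [h]

theorem allDifferentUnary_isSolution_iff {A : V → Set D} {s : V → D} :
    (allDifferentUnary A).IsSolution s ↔ (∀ v, s v ∈ A v) ∧ Function.Injective s := by
  constructor
  · intro h
    constructor
    · intro v
      have := h _ (Or.inl ⟨v, rfl⟩)
      rw [ofProp_eq_T] at this
      exact this ⟨v, rfl⟩
    · intro v w hvw
      by_contra hne
      have := h _ (Or.inr ⟨v, w, hne, rfl⟩)
      rw [ofProp_eq_T] at this
      exact hne (congrArg Subtype.val (@this ⟨v, Or.inl rfl⟩ ⟨w, Or.inr rfl⟩ hvw))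
  · rintro ⟨h1, h2⟩ c (⟨v, rfl⟩ | ⟨v, w, -, rfl⟩)
    · rw [ofProp_eq_T]
      exact fun x => h1 x.1
    · rw [ofProp_eq_T]
      exact fun x y hxy => Subtype.ext (h2 hxy)

/-- The matching consists of the edges from `v` to `s v`; injectivity of `s` is uniqueness of the
edge on the value side. -/
theorem allDifferentUnary_solvable_iff {A : V → Set D} :
    (allDifferentUnary A).Solvable ↔
      ∃ N : (valueGraph A).Subgraph, N.IsMatching ∧ ∀ v, Sum.inl v ∈ N.verts := by
  constructor
  · rintro ⟨s, hs⟩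
    obtain ⟨hA, hinj⟩ := allDifferentUnary_isSolution_iff.1 hs
    refine ⟨⟨{x | ∃ v, x = Sum.inl v ∨ x = Sum.inr (s v)},
      fun x y => ∃ v, x = Sum.inl v ∧ y = Sum.inr (s v) ∨ y = Sum.inl v ∧ x = Sum.inr (s v),
      ?_, ?_, ?_⟩, ?_, fun v => ⟨v, Or.inl rfl⟩⟩
    · rintro x y ⟨v, ⟨rfl, rfl⟩ | ⟨rfl, rfl⟩⟩
      · exact ⟨by simp, Or.inl ⟨v, s v, rfl, rfl, hA v⟩⟩
      · exact ⟨by simp, Or.inr ⟨v, s v, rfl, rfl, hA v⟩⟩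
    · rintro x y ⟨v, ⟨rfl, rfl⟩ | ⟨rfl, rfl⟩⟩
      · exact ⟨v, Or.inl rfl⟩
      · exact ⟨v, Or.inr rfl⟩
    · constructor
      rintro x y ⟨v, h⟩
      exact ⟨v, h.symm⟩
    · rintro x ⟨v, rfl | rfl⟩
      · refine ⟨Sum.inr (s v), ⟨v, Or.inl ⟨rfl, rfl⟩⟩, ?_⟩
        rintro y ⟨w, ⟨h1, h2⟩ | ⟨-, h2⟩⟩
        · rw [h2, Sum.inl.inj h1]
        · cases h2
      · refine ⟨Sum.inl v, ⟨v, Or.inr ⟨rfl, rfl⟩⟩, ?_⟩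
        rintro y ⟨w, ⟨h1, -⟩ | ⟨h1, h2⟩⟩
        · cases h1
        · rw [h1, hinj (Sum.inr.inj h2)]
  · rintro ⟨N, hN, hv⟩
    have hex : ∀ v, ∃ a, N.Adj (Sum.inl v) (Sum.inr a) ∧ a ∈ A v := by
      intro v
      obtain ⟨y, hy, -⟩ := hN (hv v)
      obtain ⟨-, ⟨v', a, h1, rfl, ha⟩ | ⟨v', a, -, h2, -⟩⟩ := N.adj_sub hy
      · obtain rfl := Sum.inl.inj h1
        exact ⟨a, hy, ha⟩
      · cases h2
    choose s hs hA using hex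
    refine ⟨s, allDifferentUnary_isSolution_iff.2 ⟨hA, fun v w hvw => ?_⟩⟩
    have h1 := (hs v).symm
    have h2 := (hs w).symm
    rw [← hvw] at h2
    exact Sum.inl.inj ((hN (N.edge_vert h1)).unique h1 h2)

/-! ### Removal of the components that are not cliques -/

section Removal

variable {M : Set P.Component}

theorem exists_of_not_mem_remaining {v : V} (hv : v ∉ P.remaining M) : ∃ H ∈ M, v ∈ vars H := by
  by_contra h
  push Not at h
  exact hv h

theorem not_mem_remaining {H : P.Component} (hH : H ∈ M) {v : V} (hv : v ∈ vars H) :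
    v ∉ P.remaining M := fun h => h H hH hv

theorem IsRemovalFamily.eq_of_mem (hM : P.IsRemovalFamily M) {H K : P.Component} (hH : H ∈ M)
    (hK : K ∈ M) {v : V} (hv : v ∈ vars H) (hv' : v ∈ vars K) : H = K := by
  by_contra hne
  exact Set.disjoint_left.1 (hM.disjoint hH hK hne) hv hv'

theorem IsRemovalFamily.exists_assignment (h : P.NegtransFree) (hM : P.IsRemovalFamily M) :
    ∃ f, P.IsRemovalAssignment M f := by
  classical
  have hH : ∀ v : {v // v ∉ P.remaining M}, ∃ H ∈ M, v.1 ∈ vars H := fun v =>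
    exists_of_not_mem_remaining v.2
  choose comp hcomp hvar using hH
  have hpq : ∀ H : P.Component, H ∈ M → ∃ p q : P.Vertex, p ∈ H.supp ∧ q ∈ H.supp ∧
      p.1.1 ≠ q.1.1 ∧ ¬ P.incGraph.Adj p q := fun H hH => by
    obtain ⟨p, hp, q, hq, h'⟩ := exists_not_adj (hM.not_clique H hH)
    exact ⟨p, q, hp, hq, h'⟩
  choose p q hp hq hne hadj using hpq
  let f : {v // v ∉ P.remaining M} → D := fun v =>
    if (p (comp v) (hcomp v)).1.1 = v.1 then (p (comp v) (hcomp v)).1.2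
    else (q (comp v) (hcomp v)).1.2
  refine ⟨f, fun H hH v w hv hw hvw => ?_⟩
  have key : ∀ v : {v // v ∉ P.remaining M}, v.1 ∈ vars H →
      (v.1 = (p H hH).1.1 ∧ (p H hH).1 = (v.1, f v)) ∨
        (v.1 = (q H hH).1.1 ∧ (q H hH).1 = (v.1, f v)) := by
    intro v hv
    -- By disjointness every variable of `H` has `H` as its chosen component, so all of them read
    -- the same chosen pair `p`, `q`.
    have hc : comp v = H := hM.eq_of_mem (hcomp v) hH (hvar v) hv
    have hf : f v = if (p H hH).1.1 = v.1 then (p H hH).1.2 else (q H hH).1.2 := by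
      simp only [f]
      congr! 2
      all_goals simp only [hc]
    rw [vars_eq_pair h (hp H hH) (hq H hH) (hne H hH) (hadj H hH)] at hv
    rcases hv with hv | hv
    · exact Or.inl ⟨hv, Prod.ext hv.symm (by rw [hf, if_pos hv.symm])⟩
    · exact Or.inr ⟨hv, Prod.ext hv.symm (by rw [hf, if_neg (hv ▸ hne H hH)])⟩
  have hvw' : v.1 ≠ w.1 := fun he => hvw (Subtype.ext he)
  rcases key v hv with ⟨h1, h2⟩ | ⟨h1, h2⟩ <;> rcases key w hw with ⟨h3, h4⟩ | ⟨h3, h4⟩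
  · exact absurd (h1.trans h3.symm) hvw'
  · exact ⟨p H hH, hp H hH, q H hH, hq H hH, h2, h4, hadj H hH⟩
  · exact ⟨q H hH, hq H hH, p H hH, hp H hH, h2, h4, fun h' => hadj H hH h'.symm⟩
  · exact absurd (h1.trans h3.symm) hvw'

theorem isSolution_restrict (h : P.IsBinaryInstance) {s : V → D} (hs : P.IsSolution s)
    (W : Set V) : (P.restrict W).IsSolution fun v => s v.1 := by
  rw [isSolution_iff h.known h.binary] at hs
  rw [restrict_isSolution_iff h]
  exact ⟨fun v => hs.1 v, fun v w => hs.2 v w⟩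

theorem IsRemovalAssignment.isSolution_iff (h : P.NegtransFree) (hM : P.IsRemovalFamily M)
    {f : {v // v ∉ P.remaining M} → D} (hf : P.IsRemovalAssignment M f) {s : V → D}
    (hs : ∀ v : {v // v ∉ P.remaining M}, s v.1 = f v) :
    P.IsSolution s ↔ (P.restrict (P.remaining M)).IsSolution fun v => s v.1 := by
  refine ⟨fun hsol => isSolution_restrict h.1 hsol _, fun hsol => ?_⟩
  rw [restrict_isSolution_iff h.1] at hsol
  have hpair : ∀ H ∈ M, ∀ v ∈ vars H, ∀ w ∈ vars H, v ≠ w →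
      ∃ p ∈ H.supp, ∃ q ∈ H.supp, p.1 = (v, s v) ∧ q.1 = (w, s w) ∧ ¬ P.incGraph.Adj p q := by
    intro H hH v hv w hw hvw
    have hv' := not_mem_remaining hH hv
    have hw' := not_mem_remaining hH hw
    rw [hs ⟨v, hv'⟩, hs ⟨w, hw'⟩]
    exact hf H hH ⟨v, hv'⟩ ⟨w, hw'⟩ hv hw fun he => hvw (congrArg Subtype.val he)
  -- A removal assignment speaks of pairs of distinct variables only; a second variable to pair `v`
  -- with exists because `H` is not a clique.
  have hmem : ∀ H ∈ M, ∀ v ∈ vars H, ∃ p ∈ H.supp, p.1 = (v, s v) := by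
    intro H hH v hv
    obtain ⟨p, hp, q, hq, hne, hadj⟩ := exists_not_adj (hM.not_clique H hH)
    by_cases hpv : p.1.1 = v
    · obtain ⟨x, hx, -, -, hxv, -⟩ := hpair H hH v hv _ ⟨q, hq, rfl⟩ (hpv ▸ hne)
      exact ⟨x, hx, hxv⟩
    · obtain ⟨x, hx, -, -, hxv, -⟩ := hpair H hH v hv _ ⟨p, hp, rfl⟩ (Ne.symm hpv)
      exact ⟨x, hx, hxv⟩
  have hperm : ∀ v, P.Permits v (s v) := by
    intro v
    by_cases hv : v ∈ P.remaining M
    · exact hsol.1 ⟨v, hv⟩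
    · obtain ⟨H, hH, hvH⟩ := exists_of_not_mem_remaining hv
      obtain ⟨p, -, hp⟩ := hmem H hH v hvH
      have := p.2
      rwa [hp] at this
  -- A conflict with a removed variable would be an edge inside its component `H`, whose assigned
  -- values were chosen non-adjacent.
  have hout : ∀ v w, v ∉ P.remaining M → ¬ P.Disallows v (s v) w (s w) := by
    intro v w hv hd
    obtain ⟨H, hH, hvH⟩ := exists_of_not_mem_remaining hv
    obtain ⟨p, hpH, hp⟩ := hmem H hH v hvH
    let r : P.Vertex := ⟨(w, s w), hperm w⟩
    have hr : P.incGraph.Adj p r := by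
      change P.Disallows p.1.1 p.1.2 w (s w)
      rw [hp]; exact hd
    have hwH : w ∈ vars H := ⟨r, mem_of_reachable hpH hr.reachable, rfl⟩
    obtain ⟨p', -, q', -, hp', hq', hadj⟩ := hpair H hH v hvH w hwH hd.1
    refine hadj ?_
    change P.Disallows p'.1.1 p'.1.2 q'.1.1 q'.1.2
    rw [hp', hq']; exact hd
  rw [CSPPattern.isSolution_iff h.1.known h.1.binary]
  refine ⟨hperm, fun v w => ?_⟩
  by_cases hv : v ∈ P.remaining M
  · by_cases hw : w ∈ P.remaining M
    · exact hsol.2 ⟨v, hv⟩ ⟨w, hw⟩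
    · exact fun hd => hout w v hw hd.symm
  · exact hout v w hv

/-- A non-adjacent pair in a component of the subinstance also lies in one component of `P`. That
component meets only the two variables of the pair, both remaining, against maximality of `M`. -/
theorem IsRemovalFamily.isInconsistencyClique (h : P.NegtransFree) (hM : P.IsRemovalFamily M)
    (K : (P.restrict (P.remaining M)).Component) : IsInconsistencyClique K := by
  by_contra hK
  obtain ⟨p, hp, q, hq, hne, hadj⟩ := exists_not_adj hK
  let φ : (P.restrict (P.remaining M)).incGraph →g P.incGraph :=
    { toFun := fun x => ⟨(x.1.1.1, x.1.2), restrict_permits.1 x.2⟩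
      map_rel' := fun hxy => restrict_disallows.1 hxy }
  have hreach : P.incGraph.Reachable (φ p) (φ q) := (reachable_of_mem hp hq).map φ
  let H : P.Component := P.incGraph.connectedComponentMk (φ p)
  have hpH : φ p ∈ H.supp := rfl
  have hqH : φ q ∈ H.supp := mem_of_reachable hpH hreach
  have hne' : (φ p).1.1 ≠ (φ q).1.1 := fun he => hne (Subtype.ext he)
  have hadj' : ¬ P.incGraph.Adj (φ p) (φ q) := fun h' => hadj (restrict_disallows.2 h')
  obtain ⟨K', hK', hdis⟩ := hM.maximal H fun hc => hadj' (hc _ hpH _ hqH hne')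
  refine hdis (Set.disjoint_left.2 fun v hv hv' => ?_)
  rw [vars_eq_pair h hpH hqH hne' hadj'] at hv
  rcases hv with rfl | rfl
  · exact p.1.1.2 K' hK' hv'
  · exact q.1.1.2 K' hK' hv'

end Removal

/-! ### The correspondence of solutions -/

/-- Adjacent vertices share a component; conversely, in a clique, vertices of different variables in
one component are adjacent. So conflicts of `s` are exactly collisions of `s'`. -/
theorem Corresponds.isSolution_iff (hk : ∀ c ∈ P.cons, ∀ ℓ, c.rel ℓ ≠ TruthVal.U)
    (hb : ∀ c ∈ P.cons, ∃ u v, c.scope = {u, v}) (hc : ∀ H : P.Component, IsInconsistencyClique H)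
    {s : V → D} {s' : V → P.Component} (h : P.Corresponds s s') :
    P.IsSolution s ↔ (allDifferentUnary P.componentsAt).IsSolution s' := by
  rw [CSPPattern.isSolution_iff hk hb, allDifferentUnary_isSolution_iff]
  choose p hp hps using h
  constructor
  · rintro ⟨-, h2⟩
    refine ⟨fun v => ⟨p v, hp v, by rw [hps v]⟩, fun v w hvw => ?_⟩
    by_contra hne
    have hadj := hc (s' v) (p v) (hp v) (p w) (hvw ▸ hp w) (by rw [hps v, hps w]; exact hne)
    change P.Disallows (p v).1.1 (p v).1.2 (p w).1.1 (p w).1.2 at hadj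
    rw [hps v, hps w] at hadj
    exact h2 v w hadj
  · rintro ⟨-, hinj⟩
    constructor
    · intro v
      have := (p v).2
      rwa [hps v] at this
    · intro v w hd
      have hadj : P.incGraph.Adj (p v) (p w) := by
        change P.Disallows (p v).1.1 (p v).1.2 (p w).1.1 (p w).1.2
        rw [hps v, hps w]; exact hd
      have hw := mem_of_reachable (hp v) hadj.reachable
      rw [SimpleGraph.ConnectedComponent.mem_supp_iff] at hw
      have hw' := hp w
      rw [SimpleGraph.ConnectedComponent.mem_supp_iff] at hw'
      exact hd.1 (hinj (hw.symm.trans hw'))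

theorem IsSolution.exists_corresponds (hk : ∀ c ∈ P.cons, ∀ ℓ, c.rel ℓ ≠ TruthVal.U)
    (hb : ∀ c ∈ P.cons, ∃ u v, c.scope = {u, v}) {s : V → D} (h : P.IsSolution s) :
    ∃ s', P.Corresponds s s' := by
  rw [isSolution_iff hk hb] at h
  exact ⟨fun v => P.incGraph.connectedComponentMk ⟨(v, s v), h.1 v⟩, fun v => ⟨_, rfl, rfl⟩⟩

theorem exists_corresponds_of_isSolution {s' : V → P.Component}
    (h : (allDifferentUnary P.componentsAt).IsSolution s') : ∃ s, P.Corresponds s s' := by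
  have h1 := (allDifferentUnary_isSolution_iff.1 h).1
  choose p hp hv using h1
  exact ⟨fun v => (p v).1.2, fun v => ⟨p v, hp v, Prod.ext (hv v) rfl⟩⟩

theorem IsRemovalFamily.solvable_iff (h : P.NegtransFree) {M : Set P.Component}
    (hM : P.IsRemovalFamily M) : P.Solvable ↔
      (allDifferentUnary (P.restrict (P.remaining M)).componentsAt).Solvable := by
  classical
  have hk := restrict_known h.1 (P.remaining M)
  have hb := restrict_binary h.1 (P.remaining M)
  have hc := hM.isInconsistencyClique h
  constructor
  · rintro ⟨s, hs⟩
    have hs₁ := isSolution_restrict h.1 hs (P.remaining M)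
    obtain ⟨s', hs'⟩ := hs₁.exists_corresponds hk hb
    exact ⟨s', (hs'.isSolution_iff hk hb hc).1 hs₁⟩
  · rintro ⟨s', hs'⟩
    obtain ⟨s, hs⟩ := exists_corresponds_of_isSolution hs'
    have hs₁ := (hs.isSolution_iff hk hb hc).2 hs'
    obtain ⟨f, hf⟩ := hM.exists_assignment h
    refine ⟨fun v => if hv : v ∈ P.remaining M then s ⟨v, hv⟩ else f ⟨v, hv⟩,
      (hf.isSolution_iff h hM fun v => dif_neg v.2).2 ?_⟩
    convert hs₁ using 2 with v
    exact dif_pos v.2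

end CSPPattern

/-! ### A random access program for these instances and its running time. -/

namespace RAM

/-! ### Reasoning about programs -/

/-- The memory `m` with register `i` set to `x`. -/
def Mem.setReg (m : Mem) (i x : ℕ) : Mem := ⟨Function.update m.reg i x, m.arr⟩

/-- The memory `m` with cell `j` of array `k` set to `x`. -/
def Mem.setArr (m : Mem) (k j x : ℕ) : Mem :=
  ⟨m.reg, Function.update m.arr k (Function.update (m.arr k) j x)⟩

@[simp] theorem Mem.setReg_reg (m : Mem) (i x j : ℕ) :
    (m.setReg i x).reg j = if j = i then x else m.reg j := by
  simp [Mem.setReg, Function.update_apply]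

@[simp] theorem Mem.setReg_arr (m : Mem) (i x : ℕ) : (m.setReg i x).arr = m.arr := rfl

@[simp] theorem Mem.setArr_reg (m : Mem) (k j x : ℕ) : (m.setArr k j x).reg = m.reg := rfl

@[simp] theorem Mem.setArr_arr (m : Mem) (k j x k' j' : ℕ) :
    (m.setArr k j x).arr k' j' = if k' = k ∧ j' = j then x else m.arr k' j' := by
  by_cases h : k' = k
  · subst h; simp [Mem.setArr, Function.update_apply]
  · simp [Mem.setArr, h]

/-- The registers a program may write. -/
def Prog.regs : Prog → List ℕ
  | .skip => []
  | .assign i _ => [i]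
  | .store _ _ _ => []
  | .seq p q => p.regs ++ q.regs
  | .ite _ p q => p.regs ++ q.regs
  | .loop _ p => p.regs

/-- The arrays a program may write. -/
def Prog.arrs : Prog → List ℕ
  | .skip => []
  | .assign _ _ => []
  | .store k _ _ => [k]
  | .seq p q => p.arrs ++ q.arrs
  | .ite _ p q => p.arrs ++ q.arrs
  | .loop _ p => p.arrs

/-- `m` and `m'` agree on all registers and arrays that `p` does not write. -/
structure Frame (p : Prog) (m m' : Mem) : Prop where
  reg : ∀ i, i ∉ p.regs → m'.reg i = m.reg i
  arr : ∀ k, k ∉ p.arrs → m'.arr k = m.arr k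

/-- The syntactic footprint allows loop invariants to mention only what the loop changes. -/
theorem Exec.frame {p : Prog} {m m' : Mem} {t : ℕ} (h : Exec p m t m') : Frame p m m' := by
  induction h with
  | skip m => exact ⟨fun _ _ => rfl, fun _ _ => rfl⟩
  | assign m i e =>
    refine ⟨fun j hj => ?_, fun _ _ => rfl⟩
    have : j ≠ i := by simpa [Prog.regs] using hj
    simp [this]
  | store m k e₁ e₂ =>
    refine ⟨fun _ _ => rfl, fun j hj => ?_⟩
    have : j ≠ k := by simpa [Prog.arrs] using hj
    simp [this]
  | seq _ _ ih₁ ih₂ =>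
    refine ⟨fun i hi => ?_, fun k hk => ?_⟩
    · simp only [Prog.regs, List.mem_append, not_or] at hi
      rw [ih₂.reg i hi.2, ih₁.reg i hi.1]
    · simp only [Prog.arrs, List.mem_append, not_or] at hk
      rw [ih₂.arr k hk.2, ih₁.arr k hk.1]
  | ite_true _ _ ih =>
    refine ⟨fun i hi => ih.reg i ?_, fun k hk => ih.arr k ?_⟩
    · simp only [Prog.regs, List.mem_append, not_or] at hi; exact hi.1
    · simp only [Prog.arrs, List.mem_append, not_or] at hk; exact hk.1
  | ite_false _ _ ih =>
    refine ⟨fun i hi => ih.reg i ?_, fun k hk => ih.arr k ?_⟩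
    · simp only [Prog.regs, List.mem_append, not_or] at hi; exact hi.2
    · simp only [Prog.arrs, List.mem_append, not_or] at hk; exact hk.2
  | loop_exit _ => exact ⟨fun _ _ => rfl, fun _ _ => rfl⟩
  | loop_step _ _ _ ih₁ ih₂ =>
    exact ⟨fun i hi => (ih₂.reg i hi).trans (ih₁.reg i hi),
      fun k hk => (ih₂.arr k hk).trans (ih₁.arr k hk)⟩

/-- Started in `m`, the program `p` halts after at most `T` steps in a memory satisfying `Q`. -/
def Runs (p : Prog) (m : Mem) (T : ℕ) (Q : Mem → Prop) : Prop :=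
  ∃ t m', Exec p m t m' ∧ t ≤ T ∧ Q m'

theorem Runs.mono {p : Prog} {m : Mem} {T T' : ℕ} {Q Q' : Mem → Prop} (h : Runs p m T Q)
    (hT : T ≤ T') (hQ : ∀ m', Frame p m m' → Q m' → Q' m') : Runs p m T' Q' := by
  obtain ⟨t, m', he, ht, hm⟩ := h
  exact ⟨t, m', he, ht.trans hT, hQ m' he.frame hm⟩

theorem Runs.seq {p q : Prog} {m : Mem} {T : ℕ} {Q : Mem → Prop} (T₁ T₂ : ℕ)
    (hp : Runs p m T₁ fun m' => Frame p m m' → Runs q m' T₂ Q) (hT : T₁ + T₂ ≤ T) :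
    Runs (.seq p q) m T Q := by
  obtain ⟨t, m', he, ht, hm⟩ := hp
  obtain ⟨t', m'', he', ht', hm'⟩ := hm he.frame
  exact ⟨_, _, .seq he he', (Nat.add_le_add ht ht').trans hT, hm'⟩

theorem Runs.ite {e : Expr} {p q : Prog} {m : Mem} {T : ℕ} {Q : Mem → Prop} (T₁ : ℕ)
    (hp : e.val m ≠ 0 → Runs p m T₁ Q) (hq : e.val m = 0 → Runs q m T₁ Q)
    (hT : e.cost + 1 + T₁ ≤ T) : Runs (.ite e p q) m T Q := by
  by_cases h : e.val m = 0
  · obtain ⟨t, m', he, ht, hm⟩ := hq h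
    exact ⟨_, _, .ite_false h he, (Nat.add_le_add_left ht _).trans hT, hm⟩
  · obtain ⟨t, m', he, ht, hm⟩ := hp h
    exact ⟨_, _, .ite_true h he, (Nat.add_le_add_left ht _).trans hT, hm⟩

/-- Programs without loops. -/
def Prog.straight : Prog → Bool
  | .seq p q => p.straight && q.straight
  | .ite _ p q => p.straight && q.straight
  | .loop _ _ => false
  | _ => true

/-- The final memory of a program without loops. -/
def Prog.run : Prog → Mem → Mem
  | .skip, m => m
  | .assign i e, m => m.setReg i (e.val m)
  | .store k e₁ e₂, m => m.setArr k (e₁.val m) (e₂.val m)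
  | .seq p q, m => q.run (p.run m)
  | .ite e p q, m => if e.val m ≠ 0 then p.run m else q.run m
  | .loop _ _, m => m

/-- A bound for the number of steps of a program without loops. -/
def Prog.bound : Prog → ℕ
  | .skip => 1
  | .assign _ e => e.cost + 1
  | .store _ e₁ e₂ => e₁.cost + e₂.cost + 1
  | .seq p q => p.bound + q.bound
  | .ite e p q => e.cost + 1 + (p.bound + q.bound)
  | .loop _ _ => 0

theorem Prog.exec_run (p : Prog) (hp : p.straight = true) (m : Mem) :
    ∃ t, Exec p m t (p.run m) ∧ t ≤ p.bound := by
  induction p generalizing m with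
  | skip => exact ⟨_, .skip m, le_rfl⟩
  | assign i e => exact ⟨_, .assign m i e, le_rfl⟩
  | store k e₁ e₂ => exact ⟨_, .store m k e₁ e₂, le_rfl⟩
  | seq p q ihp ihq =>
    simp only [Prog.straight, Bool.and_eq_true] at hp
    obtain ⟨t, h, ht⟩ := ihp hp.1 m
    obtain ⟨t', h', ht'⟩ := ihq hp.2 (p.run m)
    exact ⟨_, .seq h h', Nat.add_le_add ht ht'⟩
  | ite e p q ihp ihq =>
    simp only [Prog.straight, Bool.and_eq_true] at hp
    by_cases he : e.val m = 0
    · obtain ⟨t, h, ht⟩ := ihq hp.2 m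
      refine ⟨_, by simpa [Prog.run, he] using Exec.ite_false he h, ?_⟩
      simp only [Prog.bound]; omega
    · obtain ⟨t, h, ht⟩ := ihp hp.1 m
      refine ⟨_, by simpa [Prog.run, he] using Exec.ite_true he h, ?_⟩
      simp only [Prog.bound]; omega
  | loop e p _ => simp [Prog.straight] at hp

theorem Runs.straight {p : Prog} {m : Mem} {T : ℕ} {Q : Mem → Prop} (hp : p.straight = true)
    (hT : p.bound ≤ T) (hQ : Q (p.run m)) : Runs p m T Q := by
  obtain ⟨t, h, ht⟩ := p.exec_run hp m
  exact ⟨t, _, h, ht.trans hT, hQ⟩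

/-- Rule for loops with an invariant and a decreasing measure. -/
theorem Runs.loop {e : Expr} {p : Prog} {T : ℕ} (I : Mem → Prop) (μ : Mem → ℕ)
    (hs : ∀ m, I m → e.val m ≠ 0 → Runs p m T fun m' => Frame p m m' → I m' ∧ μ m' < μ m)
    (m : Mem) (hm : I m) :
    Runs (.loop e p) m (μ m * (T + (e.cost + 1)) + (e.cost + 1)) fun m' => I m' ∧ e.val m' = 0 := by
  induction hk : μ m using Nat.strong_induction_on generalizing m with
  | _ k ih =>
    by_cases he : e.val m = 0
    · exact ⟨_, _, .loop_exit he, by omega, hm, he⟩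
    · obtain ⟨t, m', hx, ht, hq⟩ := hs m hm he
      obtain ⟨hm', hlt⟩ := hq hx.frame
      obtain ⟨t', m'', hx', ht', hq'⟩ := ih _ (hk ▸ hlt) m' hm' rfl
      refine ⟨_, _, .loop_step he hx hx', ?_, hq'⟩
      have : (μ m' + 1) * (T + (e.cost + 1)) ≤ k * (T + (e.cost + 1)) :=
        Nat.mul_le_mul_right _ (by omega)
      rw [Nat.add_mul] at this
      omega

/-- `for i < reg lim do body`. -/
def Prog.forTo (i lim : ℕ) (body : Prog) : Prog :=
  .seq (.assign i (.lit 0))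
    (.loop (.sub (.reg lim) (.reg i)) (.seq body (.assign i (.add (.reg i) (.lit 1)))))

theorem Prog.regs_forTo (i lim : ℕ) (body : Prog) :
    (Prog.forTo i lim body).regs = i :: (body.regs ++ [i]) := rfl

theorem Prog.arrs_forTo (i lim : ℕ) (body : Prog) :
    (Prog.forTo i lim body).arrs = body.arrs ++ [] := rfl

/-- Rule for bounded loops: `I k` holds after `k` rounds. -/
theorem Runs.forTo {i lim : ℕ} {body : Prog} {m : Mem} {T' : ℕ} {Q : Mem → Prop} (N T : ℕ)
    (I : ℕ → Mem → Prop) (hN : m.reg lim = N)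
    (hi : i ∉ body.regs) (hl : lim ∉ body.regs) (hil : lim ≠ i)
    (h0 : I 0 (m.setReg i 0))
    (hs : ∀ k m', k < N → Frame (Prog.forTo i lim body) m m' → m'.reg i = k → I k m' →
      Runs body m' T fun m'' => Frame body m' m'' → I (k + 1) (m''.setReg i (k + 1)))
    (hT : N * (T + 8) + 6 ≤ T')
    (hQ : ∀ m', Frame (Prog.forTo i lim body) m m' → m'.reg i = N → I N m' → Q m') :
    Runs (Prog.forTo i lim body) m T' Q := by
  -- A round costs `T` for the body, 4 for the increment and 4 for the test; the initial assignment
  -- costs 2 and the last test 4. This is `N * (T + 8) + 6`.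
  have key := Runs.loop (e := .sub (.reg lim) (.reg i))
    (p := .seq body (.assign i (.add (.reg i) (.lit 1)))) (T := T + 4)
    (fun m' => Frame (Prog.forTo i lim body) m m' ∧ m'.reg i ≤ N ∧ I (m'.reg i) m')
    (fun m' => N - m'.reg i) ?_ (m.setReg i 0) ?_
  · obtain ⟨t, m', hx, ht, ⟨hf, hle, hI⟩, he⟩ := key
    have hlim : m'.reg lim = N := by
      rw [hf.reg lim, hN]
      simp [Prog.regs_forTo, hl, hil]
    have hiN : m'.reg i = N := by
      simp only [Expr.val, hlim] at he
      omega
    refine ⟨_, m', .seq (.assign m i (.lit 0)) hx, le_trans ?_ hT, hQ m' hf hiN (hiN ▸ hI)⟩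
    simp only [Mem.setReg_reg, if_true, Expr.cost, Nat.sub_zero] at ht ⊢
    have : T + 4 + (1 + 1 + 1 + 1) = T + 8 := by omega
    rw [this] at ht
    omega
  · rintro m' ⟨hf, hle, hI⟩ he
    have hlim : m'.reg lim = N := by
      rw [hf.reg lim, hN]
      simp [Prog.regs_forTo, hl, hil]
    have hlt : m'.reg i < N := by
      simp only [Expr.val, hlim] at he
      omega
    refine Runs.seq T 4 ((hs _ m' hlt hf rfl hI).mono le_rfl ?_) le_rfl
    intro m'' hf'' hI'' _
    have hi'' : m''.reg i = m'.reg i := hf''.reg i hi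
    refine Runs.straight rfl (by simp [Prog.bound, Expr.cost]) ?_
    intro _
    have hI''' := hI'' hf''
    simp only [Prog.run, Expr.val, hi'', Mem.setReg_reg, if_true]
    refine ⟨⟨⟨fun j hj => ?_, fun k hk => ?_⟩, by omega, hI'''⟩, by omega⟩
    · simp only [Prog.regs_forTo, List.mem_cons, List.mem_append, not_or] at hj
      rw [Mem.setReg_reg, if_neg hj.1, hf''.reg j hj.2.1,
        hf.reg j (by simp [Prog.regs_forTo, hj.1, hj.2.1])]
    · simp only [Prog.arrs_forTo, List.append_nil] at hk
      rw [Mem.setReg_arr, hf''.arr k hk, hf.arr k (by simpa [Prog.arrs_forTo] using hk)]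
  · refine ⟨⟨fun j hj => ?_, fun k _ => rfl⟩, by simp, by simpa using h0⟩
    simp only [Prog.regs_forTo, List.mem_cons, not_or] at hj
    simp [hj.1]

/-! ### Tests -/

/-- Non-zero iff `e` is zero. -/
def Expr.not (e : Expr) : Expr := .sub (.lit 1) e

/-- Non-zero iff both `e` and `f` are non-zero. -/
def Expr.and (e f : Expr) : Expr := .sub (.lit 1) (.add (.sub (.lit 1) e) (.sub (.lit 1) f))

/-- Non-zero iff `e` and `f` have the same value. -/
def Expr.eq (e f : Expr) : Expr := .sub (.lit 1) (.add (.sub e f) (.sub f e))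

theorem Expr.not_val (e : Expr) (m : Mem) : e.not.val m ≠ 0 ↔ e.val m = 0 := by
  simp only [Expr.not, Expr.val]; omega

theorem Expr.and_val (e f : Expr) (m : Mem) :
    (e.and f).val m ≠ 0 ↔ e.val m ≠ 0 ∧ f.val m ≠ 0 := by
  simp only [Expr.and, Expr.val]; omega

theorem Expr.eq_val (e f : Expr) (m : Mem) : (e.eq f).val m ≠ 0 ↔ e.val m = f.val m := by
  simp only [Expr.eq, Expr.val]; omega

/-- Frame conditions of concrete programs are discharged by evaluation. -/
theorem notMem_of_decide {i : ℕ} {l : List ℕ} (h : decide (i ∉ l) = true := by rfl) : i ∉ l :=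
  of_decide_eq_true h

/-! ### The abstract problem solved by the program -/

/-- A binary constraint network on variables below `n` and values below `d`: the permitted
values, the adjacency of its inconsistency graph, and negative transitivity. -/
structure Net (n d : ℕ) where
  perm : ℕ → ℕ → Prop
  adj : ℕ → ℕ → ℕ → ℕ → Prop
  perm_lt : ∀ {v a}, perm v a → v < n ∧ a < d
  adj_perm : ∀ {v a w b}, adj v a w b → perm v a
  adj_ne : ∀ {v a w b}, adj v a w b → v ≠ w
  symm : ∀ {v a w b}, adj v a w b → adj w b v a
  trans : ∀ {v a w b x c}, adj v a x c → adj w b x c → v ≠ w → adj v a w b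

namespace Net

variable {n d : ℕ}

/-- All neighbours of `⟨v, a⟩` belong to the variable `w`. -/
def Only (N : Net n d) (v a w : ℕ) : Prop := ∀ u c, N.adj v a u c → u = w

/-- `s` is a solution of the network. -/
def Solves (N : Net n d) (s : ℕ → ℕ) : Prop :=
  (∀ v < n, N.perm v (s v)) ∧ ∀ v < n, ∀ w < n, ¬ N.adj v (s v) w (s w)

/-- The memory holds the network together with the multiples of `d` (array `3`) and of `n * d`
(array `4`). -/
structure Encoded (N : Net n d) (m : Mem) : Prop where
  reg_n : m.reg 0 = n
  reg_d : m.reg 1 = d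
  perm : ∀ v a, v < n → a < d → (m.arr 0 (v * d + a) ≠ 0 ↔ N.perm v a)
  adj : ∀ v a w b, N.perm v a → N.perm w b →
    (m.arr 1 ((v * d + a) * (n * d) + (w * d + b)) ≠ 0 ↔ N.adj v a w b)
  mul_d : ∀ v, v < n → m.arr 3 v = v * d
  mul_row : ∀ p, p < n * d → m.arr 4 p = p * (n * d)

/-- `p` leaves the encoding of a network untouched. -/
def Keeps (p : Prog) : Bool :=
  decide (0 ∉ p.regs) && decide (1 ∉ p.regs) && decide (0 ∉ p.arrs) && decide (1 ∉ p.arrs) &&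
    decide (3 ∉ p.arrs) && decide (4 ∉ p.arrs)

theorem Encoded.frame {N : Net n d} {m m' : Mem} {p : Prog} (h : N.Encoded m) (hf : Frame p m m')
    (hp : Keeps p = true := by rfl) : N.Encoded m' := by
  simp only [Keeps, Bool.and_eq_true, decide_eq_true_eq] at hp
  obtain ⟨⟨⟨⟨⟨h0, h1⟩, a0⟩, a1⟩, a3⟩, a4⟩ := hp
  exact ⟨(hf.reg 0 h0).trans h.reg_n, (hf.reg 1 h1).trans h.reg_d,
    by rw [hf.arr 0 a0]; exact h.perm,
    by rw [hf.arr 1 a1]; exact h.adj, by rw [hf.arr 3 a3]; exact h.mul_d,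
    by rw [hf.arr 4 a4]; exact h.mul_row⟩

end Net

/-- Test whether the value `a` is permitted for the variable `v`. -/
def permE (v a : Expr) : Expr := .arr 0 (.add (.arr 3 v) a)

/-- Test whether `⟨v, a⟩` and `⟨w, b⟩` are adjacent. -/
def adjE (v a w b : Expr) : Expr :=
  ((permE v a).and (permE w b)).and
    (.arr 1 (.add (.arr 4 (.add (.arr 3 v) a)) (.add (.arr 3 w) b)))

variable {n d : ℕ} {N : Net n d}

theorem permE_val {m : Mem} (h : N.Encoded m) {v a : Expr} (hv : v.val m < n) (ha : a.val m < d) :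
    (permE v a).val m ≠ 0 ↔ N.perm (v.val m) (a.val m) := by
  simp only [permE, Expr.val, h.mul_d _ hv]
  exact h.perm _ _ hv ha

/-- The input table also records conflicts of values that a unary constraint forbids; these are not
vertices, hence the two additional permission tests. -/
theorem adjE_val {m : Mem} (h : N.Encoded m) {v a w b : Expr} (hv : v.val m < n)
    (ha : a.val m < d) (hw : w.val m < n) (hb : b.val m < d) :
    (adjE v a w b).val m ≠ 0 ↔ N.adj (v.val m) (a.val m) (w.val m) (b.val m) := by
  rw [adjE, Expr.and_val, Expr.and_val, permE_val h hv ha, permE_val h hw hb]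
  have hlt : v.val m * d + a.val m < n * d := by
    calc v.val m * d + a.val m < v.val m * d + d := by omega
      _ = (v.val m + 1) * d := by ring
      _ ≤ n * d := Nat.mul_le_mul_right _ hv
  simp only [Expr.val, h.mul_d _ hv, h.mul_d _ hw, h.mul_row _ hlt]
  constructor
  · rintro ⟨⟨h1, h2⟩, h3⟩
    exact (h.adj _ _ _ _ h1 h2).1 h3
  · intro h3
    have h1 := N.adj_perm h3
    have h2 := N.adj_perm (N.symm h3)
    exact ⟨⟨h1, h2⟩, (h.adj _ _ _ _ h1 h2).2 h3⟩

/-! ### Isolated pairs -/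

/-- For all values `a` of the variable in register `rv`, write to cell `a` of array `k` whether
`⟨v, a⟩` has a neighbour outside the variable in register `rw`. -/
def scan (rv rw k : ℕ) : Prog :=
  .forTo 5 1 (.seq (.assign 9 (.lit 0)) (.seq
    (.forTo 7 0 (.forTo 8 1 (.ite
      ((adjE (.reg rv) (.reg 5) (.reg 7) (.reg 8)).and (Expr.eq (.reg 7) (.reg rw)).not)
      (.assign 9 (.lit 1)) .skip)))
    (.store k (.reg 5) (.reg 9))))

/-- Register `9` stays `0` as long as no neighbour outside `w` is seen. The three nested loops over
`a`, `u`, `c` give about nd² steps. -/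
theorem scan_runs {m : Mem} (hE : N.Encoded m) (rv rw k v w : ℕ) (hrv : m.reg rv = v)
    (hrw : m.reg rw = w) (hv : v < n) (iv : rv ∉ (scan rv rw k).regs)
    (iw : rw ∉ (scan rv rw k).regs) (hk : Net.Keeps (scan rv rw k) = true) :
    Runs (scan rv rw k) m (d * (n * (d * 108 + 14) + 20) + 6) fun m' =>
      ∀ a < d, (m'.arr k a = 0 ↔ N.Only v a w) := by
  have iv' : rv ≠ 5 ∧ rv ≠ 9 ∧ rv ≠ 7 ∧ rv ≠ 8 := by
    simp [scan, Prog.forTo, Prog.regs] at iv; tauto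
  have iw' : rw ≠ 5 ∧ rw ≠ 9 ∧ rw ≠ 7 ∧ rw ≠ 8 := by
    simp [scan, Prog.forTo, Prog.regs] at iw; tauto
  refine Runs.forTo d (n * (d * 108 + 14) + 12)
    (fun j m' => ∀ a < j, (m'.arr k a = 0 ↔ N.Only v a w))
    hE.reg_d notMem_of_decide notMem_of_decide (by decide) (by simp) ?_ (by ring_nf; omega)
    (fun _ _ _ h => h)
  intro a m₁ ha hf₁ h5 hI
  have hE₁ := hE.frame hf₁ hk
  have hrv₁ := (hf₁.reg rv iv).trans hrv
  have hrw₁ := (hf₁.reg rw iw).trans hrw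
  refine Runs.seq 2 (n * (d * 108 + 14) + 10) (Runs.straight rfl le_rfl ?_) (by omega)
  intro hf₂
  set m₂ := (Prog.assign 9 (.lit 0)).run m₁ with hm₂
  have hE₂ := hE₁.frame hf₂
  have hrv₂ : m₂.reg rv = v := by simp [hm₂, Prog.run, iv', hrv₁]
  have hrw₂ : m₂.reg rw = w := by simp [hm₂, Prog.run, iw', hrw₁]
  have h5₂ : m₂.reg 5 = a := by simp [hm₂, Prog.run, h5]
  have h9₂ : m₂.reg 9 = 0 := by simp [hm₂, Prog.run, Expr.val]
  refine Runs.seq (n * (d * 108 + 14) + 6) 4 (Runs.forTo n (d * 108 + 6)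
    (fun j m' => m'.reg 9 = 0 ↔ ∀ u < j, ∀ c, N.adj v a u c → u = w)
    hE₂.reg_n notMem_of_decide notMem_of_decide (by decide) (by simp [h9₂]) ?_
    (by ring_nf; omega) ?_)
    (by omega)
  · intro u m₃ hu hf₃ h7 hI₃
    have hE₃ := hE₂.frame hf₃
    -- The register `rv` is a parameter, so this frame condition cannot be evaluated; the list is
    -- the write footprint of the enclosing loop.
    have ivx : rv ∉ [7, 8, 9, 8, 7] := by simp; tauto
    have iwx : rw ∉ [7, 8, 9, 8, 7] := by simp; tauto
    have hrv₃ := (hf₃.reg rv ivx).trans hrv₂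
    have hrw₃ := (hf₃.reg rw iwx).trans hrw₂
    have h5₃ := (hf₃.reg 5 notMem_of_decide).trans h5₂
    refine Runs.forTo d 100
      (fun j m' => m'.reg 9 = 0 ↔ (∀ u' < u, ∀ c, N.adj v a u' c → u' = w) ∧
        ∀ c < j, N.adj v a u c → u = w)
      hE₃.reg_d notMem_of_decide notMem_of_decide (by decide) (by simpa using hI₃) ?_
      (by ring_nf; omega) ?_
    · intro c m₄ hc hf₄ h8 hI₄
      have hE₄ := hE₃.frame hf₄
      have ivy : rv ∉ [8, 9, 8] := by simp; tauto
      have iwy : rw ∉ [8, 9, 8] := by simp; tauto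
      have hrv₄ := (hf₄.reg rv ivy).trans hrv₃
      have hrw₄ := (hf₄.reg rw iwy).trans hrw₃
      have h5₄ := (hf₄.reg 5 notMem_of_decide).trans h5₃
      have h7₄ := (hf₄.reg 7 notMem_of_decide).trans h7
      have hadj := adjE_val hE₄ (v := .reg rv) (a := .reg 5) (w := .reg 7) (b := .reg 8)
        (by simpa [Expr.val, hrv₄]) (by simpa [Expr.val, h5₄]) (by simpa [Expr.val, h7₄])
        (by simpa [Expr.val, h8])
      refine Runs.straight rfl (Nat.le_of_ble_eq_true rfl) ?_
      intro _
      simp only [Prog.run, Expr.and_val, Expr.not_val]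
      have heq := Expr.eq_val (.reg 7) (.reg rw) m₄
      simp only [Expr.val, hrv₄, hrw₄, h5₄, h7₄, h8] at hadj heq ⊢
      have hstep : (∀ c' < c + 1, N.adj v a u c' → u = w) ↔
          (∀ c' < c, N.adj v a u c' → u = w) ∧ (N.adj v a u c → u = w) := by
        constructor
        · exact fun h => ⟨fun c' hc' => h c' (by omega), h c (by omega)⟩
        · rintro ⟨h1, h2⟩ c' hc'
          rcases Nat.lt_succ_iff_lt_or_eq.1 hc' with h | rfl
          · exact h1 c' h
          · exact h2
      rw [hstep]
      split_ifs with hif <;> rw [hadj] at hif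
      · simp only [Mem.setReg_reg]
        have : u ≠ w := fun h => (heq.2 h) hif.2
        simp [hif.1, this]
      · simp only [Mem.setReg_reg]
        simp only [Nat.reduceEqDiff, if_false, hI₄]
        have : N.adj v a u c → u = w := by
          intro h
          by_contra hne
          exact hif ⟨h, by_contra fun h' => hne (heq.1 h')⟩
        exact ⟨fun h => ⟨h.1, h.2, this⟩, fun h => ⟨h.1, h.2.1⟩⟩
    · intro m₄ hf₄ h8 hI₄
      simp only [Mem.setReg_reg]
      simp only [Nat.reduceEqDiff, if_false, hI₄]
      intro _
      constructor
      · rintro ⟨h1, h2⟩ u' hu' c hadj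
        rcases Nat.lt_succ_iff_lt_or_eq.1 hu' with h | rfl
        · exact h1 u' h c hadj
        · exact h2 c (N.perm_lt (N.adj_perm (N.symm hadj))).2 hadj
      · exact fun h => ⟨fun u' hu' => h u' (by omega), fun c _ => h u (by omega) c⟩
  · intro m₃ hf₃ _ hI₃ _
    have h5₃ := (hf₃.reg 5 notMem_of_decide).trans h5₂
    have hk₃ : m₃.arr k = m₁.arr k := by
      rw [hf₃.arr k notMem_of_decide]; rfl
    refine Runs.straight rfl (Nat.le_of_ble_eq_true rfl) ?_
    intro _ a' ha'
    simp only [Prog.run, Expr.val, h5₃, Mem.setReg_arr, Mem.setArr_arr, true_and]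
    by_cases haa : a' = a
    · subst haa
      simp only [if_true, hI₃, Net.Only]
      exact ⟨fun h u c hadj => h u (N.perm_lt (N.adj_perm (N.symm hadj))).1 c hadj,
        fun h u _ c => h u c⟩
    · simp only [haa, if_false, hk₃]
      exact hI a' (by omega)

theorem Mem.setArr_arr_eq (m : Mem) (k j x k' : ℕ) :
    (m.setArr k j x).arr k' = if k' = k then Function.update (m.arr k) j x else m.arr k' := by
  by_cases h : k' = k
  · subst h; simp [Mem.setArr]
  · simp [Mem.setArr, h]

/-! ### Greedy assignment of isolated pairs. -/

namespace Net

/-- The variables `v` with `A v ≠ 0` are assigned permitted and pairwise compatible values. -/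
structure Partial (N : Net n d) (A s : ℕ → ℕ) : Prop where
  perm : ∀ v, A v ≠ 0 → N.perm v (s v)
  free : ∀ v w, A v ≠ 0 → A w ≠ 0 → ¬ N.adj v (s v) w (s w)

/-- The assigned values have neighbours in assigned variables only. -/
def Closed (N : Net n d) (A s : ℕ → ℕ) : Prop :=
  ∀ v, A v ≠ 0 → ∀ u c, N.adj v (s v) u c → A u ≠ 0

/-- The non-adjacent values `⟨v, a⟩`, `⟨w, b⟩` have no neighbours outside the variables `v, w`. -/
structure IsolatedPair (N : Net n d) (v a w b : ℕ) : Prop where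
  ne : v ≠ w
  perm_left : N.perm v a
  perm_right : N.perm w b
  not_adj : ¬ N.adj v a w b
  only_left : N.Only v a w
  only_right : N.Only w b v

theorem Partial.update {A s : ℕ → ℕ} (h : N.Partial A s) {v a : ℕ} (hp : N.perm v a)
    (hf : ∀ u, A u ≠ 0 → u ≠ v → ¬ N.adj v a u (s u)) :
    N.Partial (Function.update A v 1) (Function.update s v a) := by
  refine ⟨fun u hu => ?_, fun u w hu hw hadj => ?_⟩
  · by_cases huv : u = v
    · subst huv; simpa
    · simp only [Function.update_apply, huv, if_false] at hu ⊢
      exact h.perm u hu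
  · by_cases huv : u = v <;> by_cases hwv : w = v
    · exact N.adj_ne hadj (huv.trans hwv.symm)
    · subst huv
      simp only [Function.update_apply, hwv, if_false, if_true] at hw hadj
      exact hf w hw hwv hadj
    · subst hwv
      simp only [Function.update_apply, huv, if_false, if_true] at hu hadj
      exact hf u hu huv (N.symm hadj)
    · simp only [Function.update_apply, huv, hwv, if_false] at hu hw hadj
      exact h.free u w hu hw hadj

/-- The neighbours of either value lie in the other variable, which was unassigned and now holds a
non-adjacent value. -/
theorem IsolatedPair.partial {A s : ℕ → ℕ} {v a w b : ℕ} (hc : N.IsolatedPair v a w b)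
    (h : N.Partial A s) (hv : A v = 0) (hw : A w = 0) :
    N.Partial (Function.update (Function.update A v 1) w 1)
      (Function.update (Function.update s v a) w b) := by
  refine (h.update hc.perm_left fun u hu _ hadj => ?_).update hc.perm_right fun u hu huw hadj => ?_
  · rw [hc.only_left _ _ hadj] at hu; exact hu hw
  · have := hc.only_right _ _ hadj
    subst this
    simp only [Function.update_self] at hadj
    exact hc.not_adj (N.symm hadj)

theorem IsolatedPair.closed {A s : ℕ → ℕ} {v a w b : ℕ} (hc : N.IsolatedPair v a w b)
    (h : N.Closed A s) :
    N.Closed (Function.update (Function.update A v 1) w 1)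
      (Function.update (Function.update s v a) w b) := by
  have hne := hc.ne
  intro x hx u c hadj
  by_cases hxw : x = w
  · subst hxw
    simp only [Function.update_self] at hadj
    simp [hc.only_right _ _ hadj, Function.update_apply]
  · by_cases hxv : x = v
    · subst hxv
      rw [Function.update_of_ne hxw, Function.update_self] at hadj
      simp [hc.only_left _ _ hadj]
    · rw [Function.update_of_ne hxw, Function.update_of_ne hxv] at hadj hx
      have := h x hx u c hadj
      simp only [Function.update_apply]
      split_ifs <;> simp [this]

/-- The state of the search for isolated pairs, after the quadruples in `S` were examined. -/
structure PairInv (N : Net n d) (S : ℕ → ℕ → ℕ → ℕ → Prop) (m : Mem) : Prop where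
  valid : N.Partial (m.arr 5) (m.arr 2)
  closed : N.Closed (m.arr 5) (m.arr 2)
  done : ∀ v a w b, N.IsolatedPair v a w b → S v w a b → m.arr 5 v ≠ 0 ∨ m.arr 5 w ≠ 0

theorem PairInv.mono {S S' : ℕ → ℕ → ℕ → ℕ → Prop} {m m' : Mem} (h : N.PairInv S m)
    (h5 : m'.arr 5 = m.arr 5) (h2 : m'.arr 2 = m.arr 2)
    (hS : ∀ v a w b, N.IsolatedPair v a w b → S' v w a b → S v w a b) : N.PairInv S' m' := by
  refine ⟨?_, ?_, fun v a w b hc hs => ?_⟩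
  · rw [h5, h2]; exact h.valid
  · rw [h5, h2]; exact h.closed
  · rw [h5]; exact h.done v a w b hc (hS v a w b hc hs)

end Net

/-- Test for an isolated pair of values of two unassigned variables. -/
def pairTest : Expr :=
  (Expr.eq (.reg 3) (.reg 4)).not.and ((permE (.reg 3) (.reg 5)).and
    ((permE (.reg 4) (.reg 6)).and
      ((adjE (.reg 3) (.reg 5) (.reg 4) (.reg 6)).not.and ((Expr.arr 6 (.reg 5)).not.and
        ((Expr.arr 11 (.reg 6)).not.and ((Expr.arr 5 (.reg 3)).not.and
          (Expr.arr 5 (.reg 4)).not))))))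

/-- Assign an isolated pair of values of the variables in registers `3` and `4`. -/
def assignPair : Prog :=
  .forTo 5 1 (.forTo 6 1 (.ite pairTest
    (.seq (.store 5 (.reg 3) (.lit 1)) (.seq (.store 5 (.reg 4) (.lit 1))
      (.seq (.store 2 (.reg 3) (.reg 5)) (.store 2 (.reg 4) (.reg 6))))) .skip))

/-- Quadruples are examined in lexicographic order. One pass suffices: being an isolated pair does
not depend on the current assignment, and an assigned variable stays assigned. -/
theorem assignPair_runs {m : Mem} (hE : N.Encoded m) {v w : ℕ} (h3 : m.reg 3 = v)
    (h4 : m.reg 4 = w) (hv : v < n) (hw : w < n)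
    (hF : ∀ a < d, (m.arr 6 a = 0 ↔ N.Only v a w)) (hG : ∀ b < d, (m.arr 11 b = 0 ↔ N.Only w b v))
    (hI : N.PairInv (fun v' w' _ _ => v' < v ∨ v' = v ∧ w' < w) m) :
    Runs assignPair m (d * (d * 308 + 14) + 6)
      (N.PairInv fun v' w' _ _ => v' < v ∨ v' = v ∧ w' < w + 1) := by
  refine Runs.forTo d (d * 308 + 6)
    (fun k => N.PairInv fun v' w' a' _ =>
      v' < v ∨ v' = v ∧ (w' < w ∨ w' = w ∧ a' < k))
    hE.reg_d notMem_of_decide notMem_of_decide (by decide)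
    (hI.mono rfl rfl fun v' a' w' b' _ => by omega) ?_ (by ring_nf; omega) ?_
  swap
  · intro m' _ _ h
    refine h.mono rfl rfl fun v' a' w' b' hc => ?_
    have := (N.perm_lt hc.perm_left).2
    omega
  intro a m₁ ha hf₁ h5₁ hI₁
  have hE₁ := hE.frame hf₁
  have h3₁ := (hf₁.reg 3 notMem_of_decide).trans h3
  have h4₁ := (hf₁.reg 4 notMem_of_decide).trans h4
  rw [← hf₁.arr 6 notMem_of_decide] at hF
  rw [← hf₁.arr 11 notMem_of_decide] at hG
  refine Runs.forTo d 300
    (fun k => N.PairInv fun v' w' a' b' =>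
      v' < v ∨ v' = v ∧ (w' < w ∨ w' = w ∧ (a' < a ∨ a' = a ∧ b' < k)))
    hE₁.reg_d notMem_of_decide notMem_of_decide (by decide)
    (hI₁.mono rfl rfl fun v' a' w' b' _ => by omega) ?_ (by ring_nf; omega) ?_
  swap
  · intro m' _ _ h _
    refine h.mono rfl rfl fun v' a' w' b' hc => ?_
    have := (N.perm_lt hc.perm_right).2
    omega
  intro b m₂ hb hf₂ h6₂ hI₂
  have hE₂ := hE₁.frame hf₂
  have h3₂ := (hf₂.reg 3 notMem_of_decide).trans h3₁
  have h4₂ := (hf₂.reg 4 notMem_of_decide).trans h4₁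
  have h5₂ := (hf₂.reg 5 notMem_of_decide).trans h5₁
  have hF₂ := hF a ha
  have hG₂ := hG b hb
  rw [← hf₂.arr 6 notMem_of_decide] at hF₂
  rw [← hf₂.arr 11 notMem_of_decide] at hG₂
  have htest : pairTest.val m₂ ≠ 0 ↔
      N.IsolatedPair v a w b ∧ m₂.arr 5 v = 0 ∧ m₂.arr 5 w = 0 := by
    have hadj := adjE_val hE₂ (v := .reg 3) (a := .reg 5) (w := .reg 4) (b := .reg 6)
      (by simpa [Expr.val, h3₂]) (by simpa [Expr.val, h5₂]) (by simpa [Expr.val, h4₂])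
      (by simpa [Expr.val, h6₂])
    have hp := permE_val hE₂ (v := .reg 3) (a := .reg 5)
      (by simpa [Expr.val, h3₂]) (by simpa [Expr.val, h5₂])
    have hq := permE_val hE₂ (v := .reg 4) (a := .reg 6)
      (by simpa [Expr.val, h4₂]) (by simpa [Expr.val, h6₂])
    have heq := Expr.eq_val (.reg 3) (.reg 4) m₂
    simp only [pairTest, Expr.and_val, Expr.not_val, hp, hq]
    rw [← not_ne_iff, ← not_ne_iff (a := Expr.val m₂ (adjE _ _ _ _)), hadj, heq]
    simp only [Expr.val, h3₂, h4₂, h5₂, h6₂]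
    rw [hF₂, hG₂]
    constructor
    · rintro ⟨h1, h2, h3, h4, h5, h6, h7, h8⟩
      exact ⟨⟨h1, h2, h3, h4, h5, h6⟩, h7, h8⟩
    · rintro ⟨⟨h1, h2, h3, h4, h5, h6⟩, h7, h8⟩
      exact ⟨h1, h2, h3, h4, h5, h6, h7, h8⟩
  refine Runs.ite 20 (fun hc => ?_) (fun hc => ?_) (by decide)
  · obtain ⟨hc, hv0, hw0⟩ := htest.1 hc
    refine Runs.straight rfl (by decide) ?_
    intro _
    simp only [Prog.run, Expr.val, Mem.setArr_reg, h3₂, h4₂, h5₂, h6₂]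
    refine ⟨?_, ?_, fun v' a' w' b' hc' hS => ?_⟩
    · simpa [Mem.setArr_arr_eq] using hc.partial hI₂.valid hv0 hw0
    · simpa [Mem.setArr_arr_eq] using hc.closed hI₂.closed
    · simp only [Mem.setReg_arr, Mem.setArr_arr]
      by_cases hvv : v' = v
      · left; simp [hvv]
      by_cases hww : w' = w
      · right; simp [hww]
      have := hI₂.done v' a' w' b' hc' (by omega)
      simp only [Nat.reduceEqDiff, false_and, if_false, true_and]
      rcases this with h | h
      · left; split_ifs <;> simp [h]
      · right; split_ifs <;> simp [h]
  · refine Runs.straight rfl (by decide) ?_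
    intro _
    refine ⟨hI₂.valid, hI₂.closed, fun v' a' w' b' hc' hS => ?_⟩
    simp only [Prog.run, Mem.setReg_arr]
    by_cases hnew : v' = v ∧ w' = w ∧ a' = a ∧ b' = b
    · obtain ⟨rfl, rfl, rfl, rfl⟩ := hnew
      have : ¬ _ := fun h => htest.2 h hc
      by_contra hcon
      push Not at hcon
      exact this ⟨hc', hcon.1, hcon.2⟩
    · exact hI₂.done v' a' w' b' hc' (by omega)

/-- Assign isolated pairs of values as long as there are any. -/
def assignPairs : Prog :=
  .forTo 3 0 (.forTo 4 0 (.seq (scan 3 4 6) (.seq (scan 4 3 11) assignPair)))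

/-- The scans are made once per pair of variables, outside the loops over values; testing a pair of
values then takes constant time, and the scans dominate with n³d². -/
theorem assignPairs_runs {m : Mem} (hE : N.Encoded m) (h5 : m.arr 5 = fun _ => 0) :
    Runs assignPairs m (n * (n * (2 * (d * (n * (d * 108 + 14) + 20) + 6) + (d * (d * 308 + 14) + 6)
      + 8) + 14) + 6) (N.PairInv fun _ _ _ _ => True) := by
  refine Runs.forTo n (n * (2 * (d * (n * (d * 108 + 14) + 20) + 6) + (d * (d * 308 + 14) + 6)
      + 8) + 6)
    (fun k => N.PairInv fun v' _ _ _ => v' < k)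
    hE.reg_n notMem_of_decide notMem_of_decide (by decide)
    ⟨⟨by simp [h5], by simp [h5]⟩, fun v => by simp [h5], by simp⟩ ?_ (by ring_nf; omega) ?_
  swap
  · intro m' _ _ h
    exact h.mono rfl rfl fun v' a' w' b' hc _ => (N.perm_lt hc.perm_left).1
  intro v m₁ hv hf₁ h3₁ hI₁
  have hE₁ := hE.frame hf₁
  refine Runs.forTo n (2 * (d * (n * (d * 108 + 14) + 20) + 6) + (d * (d * 308 + 14) + 6))
    (fun k => N.PairInv fun v' w' _ _ => v' < v ∨ v' = v ∧ w' < k)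
    hE₁.reg_n notMem_of_decide notMem_of_decide (by decide)
    (hI₁.mono rfl rfl fun v' a' w' b' _ => by omega) ?_ le_rfl ?_
  swap
  · intro m' _ _ h _
    refine h.mono rfl rfl fun v' a' w' b' hc => ?_
    have := (N.perm_lt hc.perm_right).1
    omega
  intro w m₂ hw hf₂ h4₂ hI₂
  have hE₂ := hE₁.frame hf₂
  have h3₂ := (hf₂.reg 3 notMem_of_decide).trans h3₁
  refine Runs.seq (d * (n * (d * 108 + 14) + 20) + 6)
    ((d * (n * (d * 108 + 14) + 20) + 6) + (d * (d * 308 + 14) + 6))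
    ((scan_runs hE₂ 3 4 6 v w h3₂ h4₂ hv (by decide) (by decide) rfl).mono le_rfl
      fun m₃ hf₃ hF _ => ?_) (by ring_nf; omega)
  have hE₃ := hE₂.frame hf₃
  have h3₃ := (hf₃.reg 3 notMem_of_decide).trans h3₂
  have h4₃ := (hf₃.reg 4 notMem_of_decide).trans h4₂
  refine Runs.seq (d * (n * (d * 108 + 14) + 20) + 6) (d * (d * 308 + 14) + 6)
    ((scan_runs hE₃ 4 3 11 w v h4₃ h3₃ hw (by decide) (by decide) rfl).mono le_rfl
      fun m₄ hf₄ hG _ => ?_) le_rfl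
  have hE₄ := hE₃.frame hf₄
  have h3₄ := (hf₄.reg 3 notMem_of_decide).trans h3₃
  have h4₄ := (hf₄.reg 4 notMem_of_decide).trans h4₃
  rw [← hf₄.arr 6 notMem_of_decide] at hF
  refine (assignPair_runs hE₄ h3₄ h4₄ hv hw hF hG
    (hI₂.mono ?_ ?_ fun _ _ _ _ _ h => h)).mono le_rfl fun m₅ _ h _ => ?_
  · rw [hf₄.arr 5 notMem_of_decide, hf₃.arr 5 notMem_of_decide]
  · rw [hf₄.arr 2 notMem_of_decide, hf₃.arr 2 notMem_of_decide]
  · exact h.mono rfl rfl fun _ _ _ _ _ h => h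

/-- Paths of length three between unassigned variables close up when no isolated pair of values of
unassigned variables is left. -/
theorem Net.PairInv.quad {m : Mem} (h : N.PairInv (fun _ _ _ _ => True) m) {v w a a' b b' : ℕ}
    (hv : m.arr 5 v = 0) (hw : m.arr 5 w = 0) (h1 : N.adj v a w b) (h2 : N.adj v a' w b)
    (h3 : N.adj v a' w b') : N.adj v a w b' := by
  by_contra hcon
  have hvw := N.adj_ne h1
  have hp := N.adj_perm h1
  have hq := N.adj_perm (N.symm h3)
  -- A neighbour of `⟨v, a⟩` in a third variable would be adjacent, in turn, to `⟨w, b⟩`, `⟨v, a'⟩`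
  -- and `⟨w, b'⟩`, which closes the path. So an open path has an isolated pair as its ends.
  have only : ∀ {v w a a' b b' : ℕ}, N.adj v a w b → N.adj v a' w b → N.adj v a' w b' →
      ¬ N.adj v a w b' → N.Only v a w := by
    intro v w a a' b b' h1 h2 h3 hcon u c hadj
    by_contra hne
    have huv := (N.adj_ne hadj).symm
    have hvw := N.adj_ne h1
    have e1 : N.adj u c w b := N.trans (N.symm hadj) (N.symm h1) hne
    have e2 : N.adj u c v a' := N.trans e1 h2 huv
    have e3 : N.adj u c w b' := N.trans e2 (N.symm h3) hne
    exact hcon (N.trans hadj (N.symm e3) hvw)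
  have hc : N.IsolatedPair v a w b' :=
    ⟨hvw, hp, hq, hcon, only h1 h2 h3 hcon,
      only (N.symm h3) (N.symm h2) (N.symm h1) fun h => hcon (N.symm h)⟩
  rcases h.done v a w b' hc trivial with h | h
  · exact h hv
  · exact h hw

theorem Frame.trans {p : Prog} {m m' m'' : Mem} (h : Frame p m m') (h' : Frame p m' m'') :
    Frame p m m'' :=
  ⟨fun i hi => (h'.reg i hi).trans (h.reg i hi), fun k hk => (h'.arr k hk).trans (h.arr k hk)⟩

/-! ### Augmenting paths -/

namespace Net

theorem Partial.anti {A A' s : ℕ → ℕ} (h : N.Partial A s) (hA : ∀ v, A' v ≠ 0 → A v ≠ 0) :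
    N.Partial A' s :=
  ⟨fun v hv => h.perm v (hA v hv), fun v w hv hw => h.free v w (hA v hv) (hA w hw)⟩

theorem Partial.reassign {A s : ℕ → ℕ} (h : N.Partial A s) {v a : ℕ} (hp : N.perm v a)
    (hf : ∀ u, A u ≠ 0 → u ≠ v → ¬ N.adj v a u (s u)) :
    N.Partial A (Function.update s v a) := by
  refine (h.update hp hf).anti fun u hu => ?_
  by_cases huv : u = v
  · simp [huv]
  · simpa [Function.update_apply, huv] using hu

/-- A partial solution that assigns all variables outside `C`, with values that have no neighbours
in the variables of `C`. -/
structure CoreSolution (N : Net n d) (C : ℕ → Prop) (A s : ℕ → ℕ) : Prop where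
  valid : N.Partial A s
  outside : ∀ v, ¬ C v → A v ≠ 0
  separate : ∀ v, ¬ C v → ∀ u c, C u → ¬ N.adj v (s v) u c

/-- The queue of a search for an augmenting path from the variable `v₀`: array `8` lists the
variables, array `9` the positions of their predecessors, array `10` the values of the
predecessors that lead to them, and array `7` marks the variables by `v₀ + 1`. -/
structure Queue (N : Net n d) (C : ℕ → Prop) (v₀ : ℕ) (m : Mem) : Prop where
  pos : 0 < m.reg 11
  head : m.arr 8 0 = v₀
  pred_zero : m.arr 9 0 = 0
  val_zero : m.arr 10 0 = 0
  lt : ∀ j < m.reg 11, m.arr 8 j < n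
  core : ∀ j < m.reg 11, C (m.arr 8 j)
  inj : ∀ i < m.reg 11, ∀ j < m.reg 11, m.arr 8 i = m.arr 8 j → i = j
  mark : ∀ j < m.reg 11, m.arr 7 (m.arr 8 j) = v₀ + 1
  listed : ∀ u, m.arr 7 u = v₀ + 1 → ∃ j < m.reg 11, m.arr 8 j = u
  assigned : ∀ j, 0 < j → j < m.reg 11 → m.arr 5 (m.arr 8 j) ≠ 0
  pred_lt : ∀ j, 0 < j → j < m.reg 11 → m.arr 9 j < j
  step : ∀ j, 0 < j → j < m.reg 11 →
    N.adj (m.arr 8 (m.arr 9 j)) (m.arr 10 j) (m.arr 8 j) (m.arr 2 (m.arr 8 j))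
  no_return : ∀ j, 0 < j → j < m.reg 11 →
    ¬ N.adj (m.arr 8 (m.arr 9 j)) (m.arr 10 j) (m.arr 8 (m.arr 9 (m.arr 9 j)))
      (m.arr 10 (m.arr 9 j))

/-- The value `a` of the variable at position `j` of the queue leads back to its predecessor or to
a marked variable. -/
def Explored (N : Net n d) (v₀ : ℕ) (m : Mem) (j a : ℕ) : Prop :=
  N.adj (m.arr 8 j) a (m.arr 8 (m.arr 9 j)) (m.arr 10 j) ∨
    ∃ u, m.arr 7 u = v₀ + 1 ∧ m.arr 5 u ≠ 0 ∧ N.adj (m.arr 8 j) a u (m.arr 2 u)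

/-- The state of the search after the positions and values in `S` were explored. -/
structure SearchInv (N : Net n d) (C : ℕ → Prop) (v₀ : ℕ) (S : ℕ → ℕ → Prop) (m : Mem) : Prop where
  queue : N.Queue C v₀ m
  sol : N.CoreSolution C (m.arr 5) (m.arr 2)
  start : m.arr 5 v₀ = 0
  below : ∀ u < v₀, m.arr 5 u ≠ 0
  mark_le : ∀ u, m.arr 7 u ≤ v₀ + 1
  flag : m.reg 13 = 0
  explored : ∀ j < m.reg 11, ∀ a, S j a → N.perm (m.arr 8 j) a → N.Explored v₀ m j a

/-- The state after all variables below `k` were assigned. -/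
structure Extended (N : Net n d) (C : ℕ → Prop) (k : ℕ) (m : Mem) : Prop where
  sol : N.CoreSolution C (m.arr 5) (m.arr 2)
  below : ∀ u < k, m.arr 5 u ≠ 0
  mark_le : ∀ u, m.arr 7 u ≤ k
  pred_zero : m.arr 9 0 = 0
  val_zero : m.arr 10 0 = 0

theorem Queue.congr {C : ℕ → Prop} {v₀ : ℕ} {m m' : Mem} (h : N.Queue C v₀ m)
    (h11 : m'.reg 11 = m.reg 11) (h2 : m'.arr 2 = m.arr 2) (h5 : m'.arr 5 = m.arr 5)
    (h7 : m'.arr 7 = m.arr 7) (h8 : m'.arr 8 = m.arr 8) (h9 : m'.arr 9 = m.arr 9)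
    (h10 : m'.arr 10 = m.arr 10) : N.Queue C v₀ m' := by
  constructor <;> simp only [h11, h2, h5, h7, h8, h9, h10]
  exacts [h.pos, h.head, h.pred_zero, h.val_zero, h.lt, h.core, h.inj, h.mark, h.listed,
    h.assigned, h.pred_lt, h.step, h.no_return]

theorem SearchInv.congr {C : ℕ → Prop} {v₀ : ℕ} {S S' : ℕ → ℕ → Prop} {m m' : Mem}
    (h : N.SearchInv C v₀ S m)
    (h11 : m'.reg 11 = m.reg 11) (h13 : m'.reg 13 = m.reg 13) (h2 : m'.arr 2 = m.arr 2)
    (h5 : m'.arr 5 = m.arr 5) (h7 : m'.arr 7 = m.arr 7) (h8 : m'.arr 8 = m.arr 8)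
    (h9 : m'.arr 9 = m.arr 9) (h10 : m'.arr 10 = m.arr 10)
    (hS : ∀ j < m.reg 11, ∀ a, S' j a → N.perm (m.arr 8 j) a → S j a ∨ N.Explored v₀ m j a) :
    N.SearchInv C v₀ S' m' := by
  constructor <;> try simp only [Explored, h11, h13, h2, h5, h7, h8, h9, h10]
  · exact h.queue.congr h11 h2 h5 h7 h8 h9 h10
  · exact h.sol
  · exact h.start
  · exact h.below
  · exact h.mark_le
  · exact h.flag
  · intro j hj a ha hp
    rcases hS j hj a ha hp with h' | h'
    · exact h.explored j hj a h' hp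
    · exact h'

theorem Queue.pred_lt_len {C : ℕ → Prop} {v₀ : ℕ} {m : Mem} (h : N.Queue C v₀ m) {j : ℕ}
    (hj : j < m.reg 11) : m.arr 9 j < m.reg 11 := by
  rcases Nat.eq_zero_or_pos j with rfl | h0
  · rw [h.pred_zero]; exact hj
  · exact (h.pred_lt j h0 hj).trans hj

/-- The root has dummy predecessor `0` and dummy value `0`. The test for leading back then compares
two vertices of the same variable and fails, so the root needs no special case; `0 < d` keeps the
dummy in range. -/
theorem Queue.val_lt {C : ℕ → Prop} {v₀ : ℕ} {m : Mem} (h : N.Queue C v₀ m) {j : ℕ}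
    (hj : j < m.reg 11) (hd : 0 < d) : m.arr 10 j < d := by
  rcases Nat.eq_zero_or_pos j with rfl | h0
  · rw [h.val_zero]; exact hd
  · exact (N.perm_lt (N.adj_perm (h.step j h0 hj))).2

theorem Queue.len_le {C : ℕ → Prop} {v₀ : ℕ} {m : Mem} (h : N.Queue C v₀ m) : m.reg 11 ≤ n := by
  have := Finset.card_le_card_of_injOn (s := Finset.range (m.reg 11)) (t := Finset.range n)
    (m.arr 8) (fun j hj => by simpa using h.lt j (by simpa using hj))
    (fun i hi j hj hij => h.inj i (by simpa using hi) j (by simpa using hj) hij)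
  simpa using this

/-- A variable is appended to the queue. -/
theorem SearchInv.push {C : ℕ → Prop} {v₀ : ℕ} {S : ℕ → ℕ → Prop} {m m' : Mem} {k u a : ℕ}
    (h : N.SearchInv C v₀ S m) (hS' : ∀ j a, S j a → j ≤ k) (hk : k < m.reg 11) (hu : m.arr 5 u ≠ 0)
    (hnew : m.arr 7 u ≠ v₀ + 1) (hadj : N.adj (m.arr 8 k) a u (m.arr 2 u))
    (hback : ¬ N.adj (m.arr 8 k) a (m.arr 8 (m.arr 9 k)) (m.arr 10 k))
    (h11 : m'.reg 11 = m.reg 11 + 1) (h13 : m'.reg 13 = m.reg 13) (h2 : m'.arr 2 = m.arr 2)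
    (h5 : m'.arr 5 = m.arr 5) (h7 : m'.arr 7 = Function.update (m.arr 7) u (v₀ + 1))
    (h8 : m'.arr 8 = Function.update (m.arr 8) (m.reg 11) u)
    (h9 : m'.arr 9 = Function.update (m.arr 9) (m.reg 11) k)
    (h10 : m'.arr 10 = Function.update (m.arr 10) (m.reg 11) a) :
    N.SearchInv C v₀ S m' := by
  have q := h.queue
  have e8 : ∀ j < m.reg 11, m'.arr 8 j = m.arr 8 j := fun j hj => by
    rw [h8, Function.update_of_ne (by omega)]
  have e9 : ∀ j < m.reg 11, m'.arr 9 j = m.arr 9 j := fun j hj => by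
    rw [h9, Function.update_of_ne (by omega)]
  have e10 : ∀ j < m.reg 11, m'.arr 10 j = m.arr 10 j := fun j hj => by
    rw [h10, Function.update_of_ne (by omega)]
  have l8 : m'.arr 8 (m.reg 11) = u := by rw [h8, Function.update_self]
  have l9 : m'.arr 9 (m.reg 11) = k := by rw [h9, Function.update_self]
  have l10 : m'.arr 10 (m.reg 11) = a := by rw [h10, Function.update_self]
  have e7 : ∀ x, m.arr 7 x = v₀ + 1 → m'.arr 7 x = v₀ + 1 := fun x hx => by
    rw [h7, Function.update_apply]; split_ifs <;> simp [hx]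
  have l7 : m'.arr 7 u = v₀ + 1 := by rw [h7, Function.update_self]
  have cases : ∀ {j}, j < m'.reg 11 → j < m.reg 11 ∨ j = m.reg 11 := fun hj => by omega
  have hfresh : ∀ j < m.reg 11, m.arr 8 j ≠ u := fun j hj he => hnew (he ▸ q.mark j hj)
  refine ⟨⟨by omega, ?_, ?_, ?_, ?_, ?_, ?_, ?_, ?_, ?_, ?_, ?_, ?_⟩, ?_, ?_, ?_, ?_, ?_, ?_⟩
  · rw [e8 _ q.pos, q.head]
  · rw [e9 _ q.pos, q.pred_zero]
  · rw [e10 _ q.pos, q.val_zero]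
  · intro j hj
    rcases cases hj with hj | rfl
    · rw [e8 j hj]; exact q.lt j hj
    · rw [l8]; exact (N.perm_lt (h.sol.valid.perm u hu)).1
  · intro j hj
    rcases cases hj with hj | rfl
    · rw [e8 j hj]; exact q.core j hj
    · rw [l8]
      -- Values assigned outside the core have no neighbours in it, so the search never leaves the
      -- core.
      by_contra hC
      exact h.sol.separate u hC _ _ (q.core k hk) (N.symm hadj)
  · intro i hi j hj hij
    rcases cases hi with hi | rfl <;> rcases cases hj with hj | rfl
    · rw [e8 i hi, e8 j hj] at hij; exact q.inj i hi j hj hij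
    · rw [e8 i hi, l8] at hij; exact absurd hij (hfresh i hi)
    · rw [e8 j hj, l8] at hij; exact absurd hij.symm (hfresh j hj)
    · rfl
  · intro j hj
    rcases cases hj with hj | rfl
    · rw [e8 j hj]; exact e7 _ (q.mark j hj)
    · rw [l8]; exact l7
  · intro x hx
    by_cases hxu : x = u
    · exact ⟨m.reg 11, by omega, l8.trans hxu.symm⟩
    · rw [h7, Function.update_of_ne hxu] at hx
      obtain ⟨j, hj, hjx⟩ := q.listed x hx
      exact ⟨j, by omega, (e8 j hj).trans hjx⟩
  · intro j h0 hj
    rw [h5]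
    rcases cases hj with hj | rfl
    · rw [e8 j hj]; exact q.assigned j h0 hj
    · rw [l8]; exact hu
  · intro j h0 hj
    rcases cases hj with hj | rfl
    · rw [e9 j hj]; exact q.pred_lt j h0 hj
    · rw [l9]; exact hk
  · intro j h0 hj
    rw [h2]
    rcases cases hj with hj | rfl
    · rw [e9 j hj, e8 _ (q.pred_lt_len hj), e8 j hj, e10 j hj]; exact q.step j h0 hj
    · rw [l9, l8, l10, e8 k hk]; exact hadj
  · intro j h0 hj
    rcases cases hj with hj | rfl
    · have hp := q.pred_lt_len hj
      rw [e9 j hj, e8 _ hp, e10 j hj, e9 _ hp, e10 _ hp, e8 _ (q.pred_lt_len hp)]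
      exact q.no_return j h0 hj
    · rw [l9, l10, e8 k hk, e9 k hk, e10 k hk, e8 _ (q.pred_lt_len hk)]; exact hback
  · rw [h5, h2]; exact h.sol
  · rw [h5]; exact h.start
  · rw [h5]; exact h.below
  · intro x
    rw [h7, Function.update_apply]
    split_ifs
    · exact le_rfl
    · exact h.mark_le x
  · rw [h13]; exact h.flag
  · intro j hj a' hS hp
    rcases cases hj with hj | rfl
    · rw [e8 j hj] at hp
      have := h.explored j hj a' hS hp
      unfold Explored at this ⊢
      rw [e8 j hj, e9 j hj, e10 j hj, e8 _ (q.pred_lt_len hj), h5, h2]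
      rcases this with h' | ⟨x, hx, hx'⟩
      · exact Or.inl h'
      · exact Or.inr ⟨x, e7 x hx, hx'⟩
    -- The new position lies beyond `k`, so nothing is yet claimed about its values.
    · have := hS' _ _ hS
      omega

/-- A failed search shows that there is no solution. -/
theorem SearchInv.unsolvable {C : ℕ → Prop} {v₀ : ℕ} {S : ℕ → ℕ → Prop} {m : Mem}
    (h : N.SearchInv C v₀ S m) (hS : ∀ j < m.reg 11, ∀ a, S j a)
    (quad : ∀ {v w a a' b b'}, C v → C w → N.adj v a w b → N.adj v a' w b → N.adj v a' w b' →
      N.adj v a w b') (σ : ℕ → ℕ) : ¬ N.Solves σ := by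
  intro hσ
  have q := h.queue
  -- The value of `σ` at a queued variable lies in a clique occupied by a queued variable other than
  -- the root. Adjacency cannot show that the variable itself is the occupant; adjacency to the
  -- predecessor's value, which conflicts with its current value, does.
  have hex : ∀ j < m.reg 11, ∃ i, 0 < i ∧ i < m.reg 11 ∧
      ((i = j ∧ N.adj (m.arr 8 j) (σ (m.arr 8 j)) (m.arr 8 (m.arr 9 j)) (m.arr 10 j)) ∨
        N.adj (m.arr 8 j) (σ (m.arr 8 j)) (m.arr 8 i) (m.arr 2 (m.arr 8 i))) := by
    intro j hj
    rcases h.explored j hj (σ (m.arr 8 j)) (hS j hj _) (hσ.1 _ (q.lt j hj))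
      with h' | ⟨u, hu, hA, h'⟩
    · refine ⟨j, Nat.pos_of_ne_zero ?_, hj, Or.inl ⟨rfl, h'⟩⟩
      rintro rfl
      rw [q.pred_zero] at h'
      exact N.adj_ne h' rfl
    · obtain ⟨i, hi, rfl⟩ := q.listed u hu
      refine ⟨i, Nat.pos_of_ne_zero ?_, hi, Or.inr h'⟩
      rintro rfl
      rw [q.head] at hA
      exact hA h.start
  choose! g hg0 hgL hg using hex
  -- Pigeonhole: the position `0` is never the occupant, so two queued variables want the same
  -- clique and their values under `σ` conflict.
  obtain ⟨i, hi, j, hj, hij, hgij⟩ := Finset.exists_ne_map_eq_of_card_lt_of_maps_to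
    (s := Finset.range (m.reg 11)) (t := Finset.Ioo 0 (m.reg 11)) (f := g)
    (by have := q.pos; simp only [Nat.card_Ioo, Finset.card_range]; omega)
    (fun j hj => by
      have hj' := Finset.mem_range.1 hj
      exact Finset.mem_coe.2 (Finset.mem_Ioo.2 ⟨hg0 j hj', hgL j hj'⟩))
  rw [Finset.mem_range] at hi hj
  have hne : m.arr 8 i ≠ m.arr 8 j := fun he => hij (q.inj i hi j hj he)
  have hno := hσ.2 _ (q.lt i hi) _ (q.lt j hj)
  -- One variable keeps its own clique and another moves into it. If the latter is the predecessor
  -- of the former, transitivity is blocked by equal variables, and the path of length three is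
  -- closed by `quad`.
  have mixed : ∀ i j, i < m.reg 11 → j < m.reg 11 → 0 < i → m.arr 8 i ≠ m.arr 8 j →
      N.adj (m.arr 8 i) (σ (m.arr 8 i)) (m.arr 8 (m.arr 9 i)) (m.arr 10 i) →
      N.adj (m.arr 8 j) (σ (m.arr 8 j)) (m.arr 8 i) (m.arr 2 (m.arr 8 i)) →
      N.adj (m.arr 8 i) (σ (m.arr 8 i)) (m.arr 8 j) (σ (m.arr 8 j)) := by
    intro i j hi hj h0 hne h1 h2
    have hs := q.step i h0 hi
    by_cases hp : m.arr 8 (m.arr 9 i) = m.arr 8 j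
    · rw [hp] at h1 hs
      exact quad (q.core i hi) (q.core j hj) h1 (N.symm hs) (N.symm h2)
    · have h3 := N.trans h2 hs (Ne.symm hp)
      exact N.trans h1 h3 hne
  rcases hg i hi with ⟨hi', h1⟩ | h1 <;> rcases hg j hj with ⟨hj', h2⟩ | h2
  · exact hij (hi'.symm.trans (hgij.trans hj'))
  · rw [← hgij, hi'] at h2
    exact hno (mixed i j hi hj (hi' ▸ hg0 i hi) hne h1 h2)
  · rw [hgij, hj'] at h1
    exact hno (N.symm (mixed j i hj hi (hj' ▸ hg0 j hj) hne.symm h2 h1))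
  · rw [hgij] at h1
    exact hno (N.trans h1 h2 hne)

end Net

/-! ### Reassignment along an augmenting path. -/

/-- Move one step back on the augmenting path. -/
def shiftStep : Prog :=
  .seq (.store 2 (.arr 8 (.reg 15)) (.reg 16))
    (.seq (.assign 16 (.arr 10 (.reg 15))) (.assign 15 (.arr 9 (.reg 15))))

/-- Reassign the variables on the path that ends at the position in register `12` of the queue,
where the value in register `5` is free. -/
def augment : Prog :=
  .seq (.assign 15 (.reg 12)) (.seq (.assign 16 (.reg 5)) (.seq (.loop (.reg 15) shiftStep)
    (.seq (.store 2 (.reg 10) (.reg 16)) (.seq (.store 5 (.reg 10) (.lit 1))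
      (.assign 13 (.lit 1))))))

/-- The state while an augmenting path is followed back from the end, compared with the memory
`m` at the start. -/
structure Net.AugmentInv (N : Net n d) (C : ℕ → Prop) (m m' : Mem) : Prop where
  frame : Frame shiftStep m m'
  lt : m'.reg 15 < m.reg 11
  valid : N.Partial (m.arr 5) (m'.arr 2)
  perm : N.perm (m.arr 8 (m'.reg 15)) (m'.reg 16)
  free : ∀ u, m.arr 5 u ≠ 0 → u ≠ m.arr 8 (m'.reg 15) →
    ¬ N.adj (m.arr 8 (m'.reg 15)) (m'.reg 16) u (m'.arr 2 u)
  no_return : ¬ N.adj (m.arr 8 (m'.reg 15)) (m'.reg 16) (m.arr 8 (m.arr 9 (m'.reg 15)))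
    (m.arr 10 (m'.reg 15))
  earlier : ∀ i ≤ m'.reg 15, m'.arr 2 (m.arr 8 i) = m.arr 2 (m.arr 8 i)
  outside : ∀ u, ¬ C u → m'.arr 2 u = m.arr 2 u

/-- The predecessor takes the value that conflicted with the old value of the variable just moved.
Any other assigned conflict would, by transitivity, have conflicted with that old value too; the new
value is harmless by `no_return`. The queue facts still apply because earlier positions are
untouched. -/
theorem Net.AugmentInv.step {C : ℕ → Prop} {v₀ : ℕ} {m m' m'' : Mem} (h : N.AugmentInv C m m')
    (q : N.Queue C v₀ m) (h0 : m'.reg 15 ≠ 0) (hf : Frame shiftStep m' m'')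
    (h15 : m''.reg 15 = m.arr 9 (m'.reg 15)) (h16 : m''.reg 16 = m.arr 10 (m'.reg 15))
    (h2 : m''.arr 2 = Function.update (m'.arr 2) (m.arr 8 (m'.reg 15)) (m'.reg 16)) :
    N.AugmentInv C m m'' := by
  have hpos := Nat.pos_of_ne_zero h0
  have hlt := q.pred_lt _ hpos h.lt
  have hstep := q.step _ hpos h.lt
  rw [← h.earlier _ le_rfl] at hstep
  refine ⟨h.frame.trans hf, ?_, ?_, ?_, ?_, ?_, ?_, ?_⟩
  · rw [h15]; exact hlt.trans h.lt
  · rw [h2]; exact h.valid.reassign h.perm h.free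
  · rw [h15, h16]; exact N.adj_perm hstep
  · intro u hu hne hadj
    rw [h15] at hne
    rw [h15, h16, h2] at hadj
    by_cases huj : u = m.arr 8 (m'.reg 15)
    · subst huj
      rw [Function.update_self] at hadj
      exact h.no_return (N.symm hadj)
    · rw [Function.update_of_ne huj] at hadj
      exact h.valid.free _ _ hu (q.assigned _ hpos h.lt)
        (N.trans (N.symm hadj) (N.symm hstep) huj)
  · rw [h15, h16]; exact q.no_return _ hpos h.lt
  · intro i hi
    rw [h15] at hi
    rw [h2, Function.update_of_ne, h.earlier i (by omega)]
    intro he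
    have := q.inj i (by have := h.lt; omega) _ h.lt he
    omega
  · intro u hu
    rw [h2, Function.update_of_ne, h.outside u hu]
    rintro rfl
    exact hu (q.core _ h.lt)

/-- Predecessors have smaller positions, so the loop makes at most n rounds. It stops at the root,
whose value is then free and which becomes assigned. -/
theorem augment_runs {C : ℕ → Prop} {v₀ : ℕ} {S : ℕ → ℕ → Prop} {m : Mem}
    (h : N.SearchInv C v₀ S m) (h10 : m.reg 10 = v₀) (hk : m.reg 12 < m.reg 11)
    (hp : N.perm (m.arr 8 (m.reg 12)) (m.reg 5))
    (hfree : ∀ u, m.arr 5 u ≠ 0 → ¬ N.adj (m.arr 8 (m.reg 12)) (m.reg 5) u (m.arr 2 u))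
    (hback : ¬ N.adj (m.arr 8 (m.reg 12)) (m.reg 5) (m.arr 8 (m.arr 9 (m.reg 12)))
      (m.arr 10 (m.reg 12))) :
    Runs augment m (n * 20 + 30) fun m' => m'.reg 13 = 1 ∧ N.Extended C (v₀ + 1) m' := by
  have q := h.queue
  refine Runs.seq 2 (n * 20 + 28) (Runs.straight rfl le_rfl fun _ => ?_) (by omega)
  refine Runs.seq 2 (n * 20 + 26) (Runs.straight rfl le_rfl fun _ => ?_) (by omega)
  simp only [Prog.run, Expr.val, Mem.setReg_reg, Nat.reduceEqDiff, if_false]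
  set m₁ := (m.setReg 15 (m.reg 12)).setReg 16 (m.reg 5) with hm₁
  have hinv : N.AugmentInv C m m₁ := by
    refine ⟨⟨fun i hi => ?_, fun _ _ => rfl⟩, ?_, ?_, ?_, ?_, ?_, ?_, ?_⟩
    · have : i ≠ 16 ∧ i ≠ 15 := by simpa [shiftStep, Prog.regs] using hi
      simp [hm₁, this]
    · simpa [hm₁]
    · exact h.sol.valid
    · simpa [hm₁]
    · intro u hu _
      simpa [hm₁] using hfree u hu
    · simpa [hm₁] using hback
    · intro i _; rfl
    · intro u _; rfl
  have hloop := Runs.loop (e := .reg 15) (p := shiftStep) (T := 18) (N.AugmentInv C m)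
    (fun m' => m'.reg 15) ?_ m₁ hinv
  · refine Runs.seq (n * 20 + 2) 20 (hloop.mono ?_ fun m₂ _ hm₂ _ => ?_) (by omega)
    · have : m₁.reg 15 < n := by
        have := q.len_le
        simp only [hm₁, Mem.setReg_reg]
        simpa using lt_of_lt_of_le hk this
      have := Nat.mul_le_mul_right 20 this.le
      simpa [Expr.cost] using this
    · obtain ⟨hI, he⟩ := hm₂
      simp only [Expr.val] at he
      have hf := hI.frame
      have h5 := hf.arr 5 notMem_of_decide
      have h10₂ : m₂.reg 10 = v₀ := (hf.reg 10 notMem_of_decide).trans h10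
      have hperm := hI.perm
      have hfree₂ := hI.free
      rw [he, q.head] at hperm hfree₂
      have hC : C v₀ := q.head ▸ q.core 0 q.pos
      refine Runs.straight rfl (by decide) ?_
      simp only [Prog.run, Expr.val, Mem.setArr_reg, h10₂]
      refine ⟨by simp, ⟨?_, ?_, ?_⟩, ?_, ?_, ?_, ?_⟩
      · simp only [Mem.setReg_arr, Mem.setArr_arr_eq, Nat.reduceEqDiff, if_false, if_true, h5]
        exact hI.valid.update hperm hfree₂
      · intro v hv
        simp only [Mem.setReg_arr, Mem.setArr_arr, h5, Nat.reduceEqDiff, false_and, if_false]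
        split_ifs
        · simp
        · simpa using h.sol.outside v hv
      · intro v hv u c hu
        have : v ≠ v₀ := fun he => hv (he ▸ hC)
        simp only [Mem.setReg_arr, Mem.setArr_arr, this, and_false, if_false, hI.outside v hv]
        exact h.sol.separate v hv u c hu
      · intro u hu
        simp only [Mem.setReg_arr, Mem.setArr_arr, h5, Nat.reduceEqDiff, false_and, if_false]
        split_ifs with hc
        · simp
        · have := h.below u (by simp at hc; omega)
          simpa using this
      · intro u
        simp only [Mem.setReg_arr, Mem.setArr_arr, Nat.reduceEqDiff, false_and, if_false,
          hf.arr 7 notMem_of_decide]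
        exact h.mark_le u
      · simp only [Mem.setReg_arr, Mem.setArr_arr, Nat.reduceEqDiff, false_and, if_false,
          hf.arr 9 notMem_of_decide]
        exact q.pred_zero
      · simp only [Mem.setReg_arr, Mem.setArr_arr, Nat.reduceEqDiff, false_and, if_false,
          hf.arr 10 notMem_of_decide]
        exact q.val_zero
  · intro m' hI he
    simp only [Expr.val] at he
    refine Runs.straight rfl (by decide) fun hf => ?_
    have hf' := hI.frame
    have h8 := hf'.arr 8 notMem_of_decide
    have h9 := hf'.arr 9 notMem_of_decide
    have ha := hf'.arr 10 notMem_of_decide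
    have h15 : (shiftStep.run m').reg 15 = m.arr 9 (m'.reg 15) := by
      simp [shiftStep, Prog.run, Expr.val, h9]
    refine ⟨hI.step q he hf h15 ?_ ?_, ?_⟩
    · simp [shiftStep, Prog.run, Expr.val, ha]
    · simp [shiftStep, Prog.run, Expr.val, Mem.setArr_arr_eq, h8]
    · rw [h15]; exact q.pred_lt _ (Nat.pos_of_ne_zero he) hI.lt

/-! ### Breadth-first search for an augmenting path. -/

/-- Append the variable in register `7` to the queue. -/
def enqueue : Prog :=
  .seq (.store 7 (.reg 7) (.add (.reg 10) (.lit 1))) (.seq (.store 8 (.reg 11) (.reg 7))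
    (.seq (.store 9 (.reg 11) (.reg 12)) (.seq (.store 10 (.reg 11) (.reg 5))
      (.assign 11 (.add (.reg 11) (.lit 1))))))

/-- Append to the queue all assigned variables that are in conflict with the value in register `5`
of the variable at the position in register `12`; register `14` tells whether there are any. -/
def expand : Prog :=
  .forTo 7 0 (.ite ((Expr.arr 5 (.reg 7)).and
      (adjE (.arr 8 (.reg 12)) (.reg 5) (.reg 7) (.arr 2 (.reg 7))))
    (.seq (.assign 14 (.lit 1))
      (.ite (Expr.eq (.arr 7 (.reg 7)) (.add (.reg 10) (.lit 1))) .skip enqueue)) .skip)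

/-- Register `14` separates the outcomes: at `0` the value conflicts with no assigned variable and a
path can be augmented; otherwise a conflicting variable is marked and the value counts as explored.
-/
theorem expand_runs {C : ℕ → Prop} {v₀ h a v : ℕ} {S : ℕ → ℕ → Prop} {m : Mem}
    (hE : N.Encoded m) (hI : N.SearchInv C v₀ S m) (hS : ∀ j a, S j a → j ≤ h)
    (h10 : m.reg 10 = v₀) (h12 : m.reg 12 = h) (h5 : m.reg 5 = a) (hh : h < m.reg 11)
    (h14 : m.reg 14 = 0) (h8 : m.arr 8 h = v) (hp : N.perm v a)
    (hback : ¬ N.adj v a (m.arr 8 (m.arr 9 h)) (m.arr 10 h)) :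
    Runs expand m (n * 208 + 6) fun m' => N.SearchInv C v₀ S m' ∧ h < m'.reg 11 ∧
      m'.arr 8 h = v ∧ ¬ N.adj v a (m'.arr 8 (m'.arr 9 h)) (m'.arr 10 h) ∧
      (m'.reg 14 = 0 → ∀ u, m'.arr 5 u ≠ 0 → ¬ N.adj v a u (m'.arr 2 u)) ∧
      (m'.reg 14 ≠ 0 → N.Explored v₀ m' h a) := by
  refine Runs.forTo n 200
    (fun k m' => N.SearchInv C v₀ S m' ∧ h < m'.reg 11 ∧
      m'.arr 8 h = v ∧ ¬ N.adj v a (m'.arr 8 (m'.arr 9 h)) (m'.arr 10 h) ∧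
      (m'.reg 14 = 0 → ∀ u < k, m'.arr 5 u ≠ 0 → ¬ N.adj v a u (m'.arr 2 u)) ∧
      (m'.reg 14 ≠ 0 → N.Explored v₀ m' h a))
    hE.reg_n notMem_of_decide notMem_of_decide (by decide) ?_ ?_ le_rfl ?_
  · refine ⟨hI.congr rfl rfl rfl rfl rfl rfl rfl rfl fun _ _ _ h _ => Or.inl h, hh, h8,
      hback, ?_, ?_⟩
    · simp
    · intro hne; exact absurd h14 (by simpa using hne)
  · intro u m₁ hu hf₁ h7₁ ⟨hI₁, hh₁, h8₁, hback₁, hz₁, hnz₁⟩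
    have hE₁ := hE.frame hf₁
    have h10₁ := (hf₁.reg 10 notMem_of_decide).trans h10
    have h12₁ := (hf₁.reg 12 notMem_of_decide).trans h12
    have h5₁ := (hf₁.reg 5 notMem_of_decide).trans h5
    have hlt := N.perm_lt hp
    refine Runs.ite 100 (fun hc => ?_) (fun hc => ?_) (by decide)
    · rw [Expr.and_val] at hc
      obtain ⟨hA, hc⟩ := hc
      simp only [Expr.val, h7₁] at hA
      have hpu := N.perm_lt (hI₁.sol.valid.perm u hA)
      rw [adjE_val hE₁ (by simpa [Expr.val, h12₁, h8₁] using hlt.1)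
        (by simpa [Expr.val, h5₁] using hlt.2) (by simpa [Expr.val, h7₁])
        (by simpa [Expr.val, h7₁] using hpu.2)] at hc
      simp only [Expr.val, h7₁, h12₁, h8₁, h5₁] at hc
      refine Runs.seq 2 90 (Runs.straight rfl le_rfl fun _ => ?_) (by decide)
      refine Runs.ite 60 (fun hc' => ?_) (fun hc' => ?_) (by decide)
      · rw [Expr.eq_val] at hc'
        simp [Expr.val, Prog.run, h7₁, h10₁] at hc'
        refine Runs.straight rfl (by decide) fun _ => ?_
        refine ⟨hI₁.congr rfl rfl rfl rfl rfl rfl rfl rfl fun _ _ _ h _ => Or.inl h, hh₁, h8₁,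
          hback₁, ?_, ?_⟩
        · simp [Prog.run, Expr.val]
        · intro _
          exact Or.inr ⟨u, hc', hA, by simpa [Prog.run, h8₁] using hc⟩
      · have hc' : ¬ _ := fun h => (Expr.eq_val _ _ _).2 h hc'
        simp [Expr.val, Prog.run, h7₁, h10₁] at hc'
        refine Runs.straight rfl (by decide) fun _ => ?_
        set m₂ := ((enqueue.run ((Prog.assign 14 (.lit 1)).run m₁)).setReg 7 (u + 1)) with hm₂
        have e11 : m₂.reg 11 = m₁.reg 11 + 1 := by
          simp [hm₂, enqueue, Prog.run, Expr.val]
        have e2 : m₂.arr 2 = m₁.arr 2 := by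
          simp [hm₂, enqueue, Prog.run, Mem.setArr_arr_eq]
        have e5 : m₂.arr 5 = m₁.arr 5 := by
          simp [hm₂, enqueue, Prog.run, Mem.setArr_arr_eq]
        have e7 : m₂.arr 7 = Function.update (m₁.arr 7) u (v₀ + 1) := by
          simp [hm₂, enqueue, Prog.run, Expr.val, Mem.setArr_arr_eq, h7₁, h10₁]
        have e8 : m₂.arr 8 = Function.update (m₁.arr 8) (m₁.reg 11) u := by
          simp [hm₂, enqueue, Prog.run, Expr.val, Mem.setArr_arr_eq, h7₁]
        have e9 : m₂.arr 9 = Function.update (m₁.arr 9) (m₁.reg 11) h := by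
          simp [hm₂, enqueue, Prog.run, Expr.val, Mem.setArr_arr_eq, h12₁]
        have e10 : m₂.arr 10 = Function.update (m₁.arr 10) (m₁.reg 11) a := by
          simp [hm₂, enqueue, Prog.run, Expr.val, Mem.setArr_arr_eq, h5₁]
        have e14 : m₂.reg 14 = 1 := by
          simp [hm₂, enqueue, Prog.run, Expr.val]
        have ne := hh₁.ne
        have ne' := (hI₁.queue.pred_lt_len hh₁).ne
        have f8 : m₂.arr 8 h = v := by rw [e8, Function.update_of_ne ne, h8₁]
        refine ⟨hI₁.push hS hh₁ hA hc' (by rw [h8₁]; exact hc) (by rw [h8₁]; exact hback₁)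
          e11 (by simp [hm₂, enqueue, Prog.run]) e2 e5 e7 e8 e9 e10, by omega, f8, ?_, ?_, ?_⟩
        · rw [e9, Function.update_of_ne ne, e8, Function.update_of_ne ne', e10,
            Function.update_of_ne ne]
          exact hback₁
        · intro h0; rw [e14] at h0; exact absurd h0 one_ne_zero
        · intro _
          refine Or.inr ⟨u, ?_, ?_, ?_⟩
          · rw [e7, Function.update_self]
          · rw [e5]; exact hA
          · rw [f8, e2]; exact hc
    · refine Runs.straight rfl (by decide) fun _ => ?_
      refine ⟨hI₁.congr rfl rfl rfl rfl rfl rfl rfl rfl fun _ _ _ h _ => Or.inl h, hh₁, h8₁,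
          hback₁, ?_, hnz₁⟩
      intro h0 u' hu' hA hadj
      rcases Nat.lt_succ_iff_lt_or_eq.1 hu' with hlt' | rfl
      · exact hz₁ h0 u' hlt' hA hadj
      · refine absurd hc ?_
        rw [← ne_eq, Expr.and_val]
        have hpu := N.perm_lt (hI₁.sol.valid.perm u' hA)
        rw [adjE_val hE₁ (by simpa [Expr.val, h12₁, h8₁] using hlt.1)
          (by simpa [Expr.val, h5₁] using hlt.2) (by simpa [Expr.val, h7₁])
          (by simpa [Expr.val, h7₁] using hpu.2)]
        simp only [Expr.val, h7₁, h12₁, h8₁, h5₁]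
        exact ⟨hA, hadj⟩
  · rintro m' _ _ ⟨h1, h2, h3, h4, h5, h6⟩
    exact ⟨h1, h2, h3, h4, fun h0 u hA hadj =>
      h5 h0 u (N.perm_lt (N.adj_perm (N.symm hadj))).1 hA hadj, h6⟩

/-- Try the value in register `5` of the variable at the position in register `12`. -/
def tryValue : Prog :=
  .ite ((permE (.arr 8 (.reg 12)) (.reg 5)).and
      (adjE (.arr 8 (.reg 12)) (.reg 5) (.arr 8 (.arr 9 (.reg 12))) (.arr 10 (.reg 12))).not)
    (.seq (.assign 14 (.lit 0)) (.seq expand (.ite (.reg 14) .skip augment))) .skip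

/-- A value that leads back lies in the clique the variable already occupies, so it is explored
without expansion. Any other permitted value either is explored by `expand` or ends an augmenting
path. -/
theorem tryValue_runs {C : ℕ → Prop} {v₀ h a : ℕ} {m : Mem} (hE : N.Encoded m)
    (hI : N.SearchInv C v₀ (fun j a' => j < h ∨ j = h ∧ a' < a) m)
    (h10 : m.reg 10 = v₀) (h12 : m.reg 12 = h) (h5 : m.reg 5 = a) (hh : h < m.reg 11)
    (ha : a < d) :
    Runs tryValue m (n * 228 + 140) fun m' =>
      (N.SearchInv C v₀ (fun j a' => j < h ∨ j = h ∧ a' < a + 1) m' ∧ h < m'.reg 11) ∨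
        (m'.reg 13 = 1 ∧ N.Extended C (v₀ + 1) m') := by
  have q := hI.queue
  have hlt := q.pred_lt_len hh
  have next : ∀ m' : Mem, N.SearchInv C v₀ (fun j a' => j < h ∨ j = h ∧ a' < a) m' →
      (N.perm (m'.arr 8 h) a → N.Explored v₀ m' h a) →
      N.SearchInv C v₀ (fun j a' => j < h ∨ j = h ∧ a' < a + 1) m' := by
    intro m' hI' hex
    refine hI'.congr rfl rfl rfl rfl rfl rfl rfl rfl fun j _ a' hS hp => ?_
    by_cases hnew : j = h ∧ a' = a
    · obtain ⟨rfl, rfl⟩ := hnew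
      exact Or.inr (hex hp)
    · exact Or.inl (by omega)
  have hperm := permE_val hE (v := .arr 8 (.reg 12)) (a := .reg 5)
    (by simpa [Expr.val, h12] using q.lt h hh) (by simpa [Expr.val, h5])
  have hadj := adjE_val hE (v := .arr 8 (.reg 12)) (a := .reg 5) (w := .arr 8 (.arr 9 (.reg 12)))
    (b := .arr 10 (.reg 12)) (by simpa [Expr.val, h12] using q.lt h hh) (by simpa [Expr.val, h5])
    (by simpa [Expr.val, h12] using q.lt _ hlt)
    (by simpa [Expr.val, h12] using q.val_lt hh (by omega))
  simp only [Expr.val, h12, h5] at hperm hadj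
  refine Runs.ite (n * 228 + 60) (fun hc => ?_) (fun hc => ?_)
    (by simp only [Expr.cost, Expr.and, Expr.not, permE, adjE]; omega)
  · rw [Expr.and_val, Expr.not_val, hperm] at hc
    obtain ⟨hp, hback⟩ := hc
    have hback : ¬ _ := fun h => hadj.2 h hback
    refine Runs.seq 2 (n * 228 + 50) (Runs.straight rfl le_rfl fun hf₁ => ?_) (by omega)
    refine Runs.seq (n * 208 + 6) (n * 20 + 40)
      ((expand_runs (S := fun j a' => j < h ∨ j = h ∧ a' < a)
      (v := m.arr 8 h) (a := a) (h := h) (hE.frame hf₁)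
      (hI.congr rfl rfl rfl rfl rfl rfl rfl rfl fun _ _ _ h _ => Or.inl h)
      (fun j a' hS => by omega) h10 h12 h5 hh rfl rfl hp hback).mono le_rfl ?_) (by omega)
    rintro m₂ hf₂ ⟨hI₂, hh₂, h8₂, hback₂, hz, hnz⟩ _
    have h10₂ : m₂.reg 10 = v₀ := (hf₂.reg 10 notMem_of_decide).trans h10
    have h12₂ : m₂.reg 12 = h := (hf₂.reg 12 notMem_of_decide).trans h12
    have h5₂ : m₂.reg 5 = a := (hf₂.reg 5 notMem_of_decide).trans h5
    refine Runs.ite (n * 20 + 30) (fun hc => ?_) (fun hc => ?_) (by simp only [Expr.cost]; omega)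
    · exact Runs.straight rfl (by simp [Prog.bound]) (Or.inl ⟨next m₂ hI₂ fun _ => hnz hc, hh₂⟩)
    · refine (augment_runs hI₂ h10₂ (by rw [h12₂]; exact hh₂) (by rw [h12₂, h5₂, h8₂]; exact hp)
        (by rw [h12₂, h5₂, h8₂]; exact hz hc)
        (by rw [h12₂, h5₂, h8₂]; exact hback₂)).mono le_rfl fun _ _ h => Or.inr h
  · refine Runs.straight rfl (by simp [Prog.bound]) (Or.inl ⟨next m hI fun hp => ?_, hh⟩)
    by_contra hcon
    refine absurd hc ?_
    rw [← ne_eq, Expr.and_val, Expr.not_val, hperm]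
    refine ⟨hp, ?_⟩
    by_contra h0
    exact hcon (Or.inl (hadj.1 h0))

/-- Search for an augmenting path from the variable in register `10`; if there is none, set
register `17`. -/
def search : Prog :=
  .seq (.seq (.store 8 (.lit 0) (.reg 10)) (.seq (.store 7 (.reg 10) (.add (.reg 10) (.lit 1)))
      (.seq (.assign 11 (.lit 1)) (.assign 13 (.lit 0)))))
    (.seq (.forTo 12 0 (.ite (.sub (.reg 11) (.reg 12))
        (.forTo 5 1 (.ite (.reg 13) .skip tryValue)) .skip))
      (.ite (.reg 13) .skip (.assign 17 (.lit 1))))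

theorem search_runs {C : ℕ → Prop} {v₀ : ℕ} {m : Mem} (hE : N.Encoded m)
    (quad : ∀ {v w a a' b b'}, C v → C w → N.adj v a w b → N.adj v a' w b → N.adj v a' w b' →
      N.adj v a w b')
    (hX : N.Extended C v₀ m) (h10 : m.reg 10 = v₀) (h17 : m.reg 17 = 0) (hv : v₀ < n)
    (h0 : m.arr 5 v₀ = 0) :
    Runs search m (n * (d * (n * 228 + 150) + 20) + 36) fun m' =>
      (m'.reg 17 = 0 ∧ N.Extended C (v₀ + 1) m') ∨ (m'.reg 17 ≠ 0 ∧ ∀ σ, ¬ N.Solves σ) := by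
  refine Runs.seq 16 (n * (d * (n * 228 + 150) + 20) + 16)
    (Runs.straight rfl (by decide) fun hf₁ => ?_)
    (by omega)
  set m₁ := Prog.run _ m with hm₁
  have hE₁ := hE.frame hf₁
  have h10₁ : m₁.reg 10 = v₀ := (hf₁.reg 10 notMem_of_decide).trans h10
  have h17₁ : m₁.reg 17 = 0 := (hf₁.reg 17 notMem_of_decide).trans h17
  have e11 : m₁.reg 11 = 1 := by simp [hm₁, Prog.run, Expr.val]
  have e13 : m₁.reg 13 = 0 := by simp [hm₁, Prog.run, Expr.val]
  have e8 : m₁.arr 8 0 = v₀ := by simp [hm₁, Prog.run, Expr.val, h10]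
  have e7 : m₁.arr 7 = Function.update (m.arr 7) v₀ (v₀ + 1) := by
    simp [hm₁, Prog.run, Expr.val, Mem.setArr_arr_eq, h10]
  have e5 := hf₁.arr 5 notMem_of_decide
  have e2 := hf₁.arr 2 notMem_of_decide
  have e9 := hf₁.arr 9 notMem_of_decide
  have e10 := hf₁.arr 10 notMem_of_decide
  have hC : C v₀ := by
    by_contra hC
    exact hX.sol.outside v₀ hC h0
  have hq : N.Queue C v₀ m₁ := by
    have hz : ∀ j < m₁.reg 11, j = 0 := fun j hj => by omega
    refine ⟨by omega, e8, by rw [e9]; exact hX.pred_zero, by rw [e10]; exact hX.val_zero,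
      fun j hj => ?_, fun j hj => ?_, fun i hi j hj _ => by omega, fun j hj => ?_, fun u hu => ?_,
      fun j h0 hj => by omega, fun j h0 hj => by omega, fun j h0 hj => by omega,
      fun j h0 hj => by omega⟩
    · rw [hz j hj, e8]; exact hv
    · rw [hz j hj, e8]; exact hC
    · rw [hz j hj, e8, e7, Function.update_self]
    -- Earlier marks are at most `v₀`, so the mark `v₀ + 1` is fresh and the array never has to be
    -- cleared.
    · refine ⟨0, by omega, ?_⟩
      by_contra hne
      rw [e7, Function.update_of_ne (by rw [e8] at hne; exact Ne.symm hne)] at hu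
      have := hX.mark_le u
      omega
  have hI₁ : N.SearchInv C v₀ (fun j _ => j < 0) m₁ := by
    refine ⟨hq, by rw [e5, e2]; exact hX.sol, by rw [e5]; exact h0, by rw [e5]; exact hX.below,
      fun u => ?_, e13, by simp⟩
    rw [e7, Function.update_apply]
    have := hX.mark_le u
    split_ifs <;> omega
  -- The queue grows during the loop, so the loop always makes n rounds. Rounds beyond the end of
  -- the queue or after success are idle; n rounds suffice since queued variables are distinct.
  refine Runs.seq (n * (d * (n * 228 + 150) + 20) + 6) 8 (Runs.forTo n (d * (n * 228 + 150) + 12)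
    (fun k m' => N.SearchInv C v₀ (fun j _ => j < k) m' ∨
      (m'.reg 13 = 1 ∧ N.Extended C (v₀ + 1) m'))
    hE₁.reg_n notMem_of_decide notMem_of_decide (by decide) ?_ ?_ (by ring_nf; omega) ?_) (by omega)
  · exact Or.inl (hI₁.congr rfl rfl rfl rfl rfl rfl rfl rfl fun _ _ _ h _ => Or.inl h)
  · intro h m₂ hh hf₂ h12₂ hJ
    have hE₂ := hE₁.frame hf₂
    have h10₂ := (hf₂.reg 10 notMem_of_decide).trans h10₁
    refine Runs.ite (d * (n * 228 + 150) + 6) (fun hc => ?_) (fun hc => ?_)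
      (by simp only [Expr.cost]; omega)
    · simp only [Expr.val, h12₂] at hc
      refine Runs.forTo d (n * 228 + 142)
        (fun k m' => (N.SearchInv C v₀ (fun j a' => j < h ∨ j = h ∧ a' < k) m' ∧ h < m'.reg 11) ∨
          (m'.reg 13 = 1 ∧ N.Extended C (v₀ + 1) m'))
        hE₂.reg_d notMem_of_decide notMem_of_decide (by decide) ?_ ?_ (by ring_nf; omega) ?_
      · rcases hJ with hJ | ⟨hJ, hJ'⟩
        · refine Or.inl ⟨hJ.congr rfl rfl rfl rfl rfl rfl rfl rfl fun _ _ _ h _ => Or.inl ?_, ?_⟩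
          · omega
          · simp; omega
        · exact Or.inr ⟨hJ, hJ'.sol, hJ'.below, hJ'.mark_le, hJ'.pred_zero, hJ'.val_zero⟩
      · intro a m₃ ha hf₃ h5₃ hK
        refine Runs.ite (n * 228 + 140) (fun hc => ?_) (fun hc => ?_)
          (by simp only [Expr.cost]; omega)
        · refine Runs.straight rfl (by simp [Prog.bound]) fun _ => ?_
          rcases hK with hK | ⟨hK, hK'⟩
          · exact absurd hK.1.flag hc
          · exact Or.inr ⟨hK, hK'.sol, hK'.below, hK'.mark_le, hK'.pred_zero, hK'.val_zero⟩
        · rcases hK with hK | ⟨hK, hK'⟩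
          · refine (tryValue_runs (hE₂.frame hf₃) hK.1
              ((hf₃.reg 10 notMem_of_decide).trans h10₂)
              ((hf₃.reg 12 notMem_of_decide).trans h12₂) h5₃ hK.2 ha).mono le_rfl ?_
            rintro m₄ _ (hL | ⟨hL, hL'⟩) _
            · exact Or.inl ⟨hL.1.congr rfl rfl rfl rfl rfl rfl rfl rfl
                fun _ _ _ h _ => Or.inl h, hL.2⟩
            · exact Or.inr ⟨hL, hL'.sol, hL'.below, hL'.mark_le, hL'.pred_zero, hL'.val_zero⟩
          · simp only [Expr.val] at hc
            omega
      · rintro m₃ _ _ (hK | ⟨hK, hK'⟩) _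
        · refine Or.inl (hK.1.congr rfl rfl rfl rfl rfl rfl rfl rfl fun j _ a hj hp => Or.inl ?_)
          have := (N.perm_lt hp).2
          omega
        · exact Or.inr ⟨hK, hK'.sol, hK'.below, hK'.mark_le, hK'.pred_zero, hK'.val_zero⟩
    · simp only [Expr.val, h12₂] at hc
      refine Runs.straight rfl (by simp [Prog.bound]) fun _ => ?_
      rcases hJ with hJ | ⟨hJ, hJ'⟩
      · exact Or.inl (hJ.congr rfl rfl rfl rfl rfl rfl rfl rfl fun j _ _ h _ => Or.inl (by omega))
      · exact Or.inr ⟨hJ, hJ'.sol, hJ'.below, hJ'.mark_le, hJ'.pred_zero, hJ'.val_zero⟩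
  · intro m₂ hf₂ _ hJ _
    have h17₂ := (hf₂.reg 17 notMem_of_decide).trans h17₁
    refine Runs.ite 2 (fun hc => ?_) (fun hc => ?_) (by decide)
    · refine Runs.straight rfl (by decide) ?_
      rcases hJ with hJ | ⟨_, hJ⟩
      · exact absurd hJ.flag hc
      · exact Or.inl ⟨h17₂, hJ⟩
    · refine Runs.straight rfl (by decide) ?_
      rcases hJ with hJ | ⟨hJ, _⟩
      · refine Or.inr ⟨by simp [Prog.run, Expr.val], fun σ =>
          hJ.unsolvable (fun j hj _ => ?_) quad σ⟩
        exact hj.trans_le hJ.queue.len_le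
      · simp only [Expr.val] at hc
        omega

/-- Assign the variables that are still unassigned, one after the other. -/
def assignRest : Prog :=
  .forTo 10 0 (.ite ((Expr.arr 5 (.reg 10)).not.and (Expr.reg 17).not) search .skip)

/-- The core `C` stays fixed while its variables become assigned. After a failure register `17`
suppresses all further searches. -/
theorem assignRest_runs {C : ℕ → Prop} {m : Mem} (hE : N.Encoded m)
    (quad : ∀ {v w a a' b b'}, C v → C w → N.adj v a w b → N.adj v a' w b → N.adj v a' w b' →
      N.adj v a w b')
    (hX : N.Extended C 0 m) (h17 : m.reg 17 = 0) :
    Runs assignRest m (n * (n * (d * (n * 228 + 150) + 20) + 70) + 6) fun m' =>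
      (m'.reg 17 = 0 ∧ N.Solves (m'.arr 2)) ∨ (m'.reg 17 ≠ 0 ∧ ∀ σ, ¬ N.Solves σ) := by
  refine Runs.forTo n (n * (d * (n * 228 + 150) + 20) + 60)
    (fun k m' => (m'.reg 17 = 0 ∧ N.Extended C k m') ∨ (m'.reg 17 ≠ 0 ∧ ∀ σ, ¬ N.Solves σ))
    hE.reg_n notMem_of_decide notMem_of_decide (by decide)
    (Or.inl ⟨h17, hX.sol, hX.below, hX.mark_le, hX.pred_zero, hX.val_zero⟩) ?_
    (by ring_nf; omega) ?_
  · intro v₀ m₁ hv hf₁ h10 hJ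
    refine Runs.ite (n * (d * (n * 228 + 150) + 20) + 36) (fun hc => ?_) (fun hc => ?_)
      (by simp only [Expr.cost, Expr.and, Expr.not]; omega)
    · rw [Expr.and_val, Expr.not_val, Expr.not_val] at hc
      simp only [Expr.val, h10] at hc
      rcases hJ with hJ | hJ
      · refine (search_runs (hE.frame hf₁) quad hJ.2 h10 hJ.1 hv hc.1).mono le_rfl ?_
        rintro m₂ _ (⟨h, hL⟩ | h) _
        · exact Or.inl ⟨h, hL.sol, hL.below, hL.mark_le, hL.pred_zero, hL.val_zero⟩
        · exact Or.inr h
      · exact absurd hc.2 hJ.1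
    · refine Runs.straight rfl (by simp [Prog.bound]) fun _ => ?_
      rcases hJ with ⟨h, hL⟩ | hJ
      · refine Or.inl ⟨h, hL.sol, fun u hu => ?_, fun u => (hL.mark_le u).trans (by omega),
          hL.pred_zero, hL.val_zero⟩
        rcases Nat.lt_succ_iff_lt_or_eq.1 hu with hu | rfl
        · exact hL.below u hu
        · intro h5
          refine absurd hc ?_
          rw [← ne_eq, Expr.and_val, Expr.not_val, Expr.not_val]
          simp only [Expr.val, h10]
          exact ⟨h5, h⟩
      · exact Or.inr hJ
  · rintro m' _ _ (⟨h, hL⟩ | h)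
    · exact Or.inl ⟨h, fun v hv => hL.sol.valid.perm v (hL.below v hv), fun v hv w hw =>
        hL.sol.valid.free v w (hL.below v hv) (hL.below w hw)⟩
    · exact Or.inr h

/-! ### The program -/

/-- Write `n * d` to register `2`, the multiples of `d` to array `3` and those of `n * d` to
array `4`. -/
def prepare : Prog :=
  .seq (.forTo 3 0 (.seq (.store 3 (.reg 3) (.reg 2)) (.assign 2 (.add (.reg 2) (.reg 1)))))
    (.forTo 3 2 (.seq (.store 4 (.reg 3) (.reg 18)) (.assign 18 (.add (.reg 18) (.reg 2)))))

theorem prepare_runs {m : Mem} (h0 : m.reg 0 = n) (h1 : m.reg 1 = d) (h2 : m.reg 2 = 0)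
    (h18 : m.reg 18 = 0) :
    Runs prepare m (n * 15 + n * d * 15 + 12) fun m' =>
      (∀ v, v < n → m'.arr 3 v = v * d) ∧ ∀ p, p < n * d → m'.arr 4 p = p * (n * d) := by
  refine Runs.seq (n * 15 + 6) (n * d * 15 + 6) (Runs.forTo n 7
    (fun k m' => m'.reg 2 = k * d ∧ ∀ v < k, m'.arr 3 v = v * d) h0 notMem_of_decide
    notMem_of_decide (by decide) ?_ ?_ le_rfl ?_) (by omega)
  · simp [h2]
  · rintro k m₁ hk hf₁ h3₁ ⟨h2₁, hI₁⟩
    have h1₁ := (hf₁.reg 1 notMem_of_decide).trans h1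
    refine Runs.straight rfl (by decide) fun _ => ⟨?_, fun v hv => ?_⟩
    · simp [Prog.run, Expr.val, h2₁, h1₁]; ring
    · simp only [Prog.run, Expr.val, Mem.setReg_arr, Mem.setArr_arr, h3₁, h2₁, true_and]
      split_ifs with hvk
      · rw [hvk]
      · exact hI₁ v (by omega)
  · rintro m₁ hf₁ - ⟨h2₁, hI₁⟩ -
    have h18₁ := (hf₁.reg 18 notMem_of_decide).trans h18
    refine Runs.forTo (n * d) 7
      (fun k m' => m'.reg 18 = k * (n * d) ∧ ∀ p < k, m'.arr 4 p = p * (n * d)) h2₁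
      notMem_of_decide notMem_of_decide (by decide) ?_ ?_ le_rfl ?_
    · simp [h18₁]
    · rintro k m₂ hk hf₂ h3₂ ⟨h18₂, hI₂⟩
      have h2₂ := (hf₂.reg 2 notMem_of_decide).trans h2₁
      refine Runs.straight rfl (by decide) fun _ => ⟨?_, fun v hv => ?_⟩
      · simp [Prog.run, Expr.val, h18₂, h2₂]; ring
      · simp only [Prog.run, Expr.val, Mem.setReg_arr, Mem.setArr_arr, h3₂, h18₂, true_and]
        split_ifs with hvk
        · rw [hvk]
        · exact hI₂ v (by omega)
    · rintro m₂ hf₂ - ⟨-, hI₂⟩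
      refine ⟨?_, hI₂⟩
      rw [hf₂.arr 3 notMem_of_decide]
      exact hI₁

/-- The network of an instance. -/
def netOf (P : CSPPattern (Fin n) (Fin d)) (h : P.NegtransFree) : Net n d where
  perm v a := ∃ (hv : v < n) (ha : a < d), P.Permits ⟨v, hv⟩ ⟨a, ha⟩
  adj v a w b := ∃ (hv : v < n) (ha : a < d) (hw : w < n) (hb : b < d),
    P.Permits ⟨v, hv⟩ ⟨a, ha⟩ ∧ P.Permits ⟨w, hw⟩ ⟨b, hb⟩ ∧
      P.Disallows ⟨v, hv⟩ ⟨a, ha⟩ ⟨w, hw⟩ ⟨b, hb⟩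
  perm_lt := fun ⟨hv, ha, _⟩ => ⟨hv, ha⟩
  adj_perm := fun ⟨hv, ha, _, _, hp, _⟩ => ⟨hv, ha, hp⟩
  adj_ne := fun ⟨_, _, _, _, _, _, hd⟩ he => hd.1 (Fin.ext he)
  symm := fun ⟨hv, ha, hw, hb, hp, hq, hd⟩ => ⟨hw, hb, hv, ha, hq, hp, hd.symm⟩
  trans := fun ⟨hv, ha, _, _, hp, _, hd⟩ ⟨hw, hb, _, _, hq, _, hd'⟩ hne =>
    ⟨hv, ha, hw, hb, hp, hq, h.disallows hd hd' fun he => hne (congrArg Fin.val he)⟩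

theorem netOf_solves_iff {P : CSPPattern (Fin n) (Fin d)} (h : P.NegtransFree) {s : Fin n → Fin d}
    {σ : ℕ → ℕ} (hσ : ∀ v : Fin n, σ v.1 = (s v).1) : (netOf P h).Solves σ ↔ P.IsSolution s := by
  rw [CSPPattern.isSolution_iff h.1.known h.1.binary]
  constructor
  · rintro ⟨h1, h2⟩
    have hp : ∀ v, P.Permits v (s v) := fun v => by
      obtain ⟨_, _, hp⟩ := h1 v.1 v.2
      simpa only [hσ v] using hp
    refine ⟨hp, fun v w hd => h2 v.1 v.2 w.1 w.2 ?_⟩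
    rw [hσ v, hσ w]
    exact ⟨v.2, (s v).2, w.2, (s w).2, hp v, hp w, hd⟩
  · rintro ⟨h1, h2⟩
    refine ⟨fun v hv => ?_, fun v hv w hw hadj => ?_⟩
    · have := hσ ⟨v, hv⟩
      simp only at this
      rw [this]
      exact ⟨hv, (s ⟨v, hv⟩).2, h1 ⟨v, hv⟩⟩
    · have hv' := hσ ⟨v, hv⟩
      have hw' := hσ ⟨w, hw⟩
      simp only at hv' hw'
      rw [hv', hw'] at hadj
      obtain ⟨_, _, _, _, _, _, hd⟩ := hadj
      exact h2 _ _ hd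

theorem pair_index_inj {k v w a b : ℕ} (ha : a < k) (hb : b < k) (h : v * k + a = w * k + b) :
    v = w ∧ a = b := by
  have hk : 0 < k := by omega
  have h1 : (v * k + a) / k = v := by
    rw [Nat.add_comm, Nat.add_mul_div_right _ _ hk, Nat.div_eq_of_lt ha, Nat.zero_add]
  have h2 : (w * k + b) / k = w := by
    rw [Nat.add_comm, Nat.add_mul_div_right _ _ hk, Nat.div_eq_of_lt hb, Nat.zero_add]
  have hvw : v = w := by rw [← h1, h, h2]
  subst hvw
  exact ⟨rfl, by omega⟩

theorem pair_index_lt {k l v a : ℕ} (hv : v < l) (ha : a < k) : v * k + a < l * k :=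
  calc v * k + a < v * k + k := by omega
    _ = (v + 1) * k := by ring
    _ ≤ l * k := Nat.mul_le_mul_right _ hv

/-- The tables are stored row by row, and the address of an entry determines its indices as long as
the values are in range. -/
theorem encoded_of_input {P : CSPPattern (Fin n) (Fin d)} (h : P.NegtransFree) {m : Mem}
    (h0 : m.reg 0 = n) (h1 : m.reg 1 = d) (a0 : m.arr 0 = (input P).arr 0)
    (a1 : m.arr 1 = (input P).arr 1) (a3 : ∀ v, v < n → m.arr 3 v = v * d)
    (a4 : ∀ p, p < n * d → m.arr 4 p = p * (n * d)) : (netOf P h).Encoded m := by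
  refine ⟨h0, h1, fun v a hv ha => ?_, ?_, a3, a4⟩
  · rw [a0]
    simp only [input, true_and, zero_ne_one, false_and, or_false, ne_eq, ite_eq_right_iff,
      one_ne_zero, imp_false, not_not]
    constructor
    · rintro ⟨v', a', he, hp⟩
      obtain ⟨rfl, rfl⟩ := pair_index_inj ha a'.2 he
      exact ⟨hv, ha, hp⟩
    · rintro ⟨hv, ha, hp⟩
      exact ⟨_, _, rfl, hp⟩
  · rintro v a w b ⟨hv, ha, hp⟩ ⟨hw, hb, hq⟩
    rw [a1]
    simp only [input, true_and, one_ne_zero, false_and, false_or, ne_eq, ite_eq_right_iff,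
      imp_false, not_not]
    constructor
    · rintro ⟨v', a', w', b', he, hd⟩
      obtain ⟨he₁, he₂⟩ := pair_index_inj (pair_index_lt hw hb) (pair_index_lt w'.2 b'.2) he
      obtain ⟨rfl, rfl⟩ := pair_index_inj ha a'.2 he₁
      obtain ⟨rfl, rfl⟩ := pair_index_inj hb b'.2 he₂
      exact ⟨hv, ha, hw, hb, hp, hq, hd⟩
    · rintro ⟨hv, ha, hw, hb, -, -, hd⟩
      exact ⟨_, _, _, _, rfl, hd⟩

/-- The program that solves instances without the negative transitive pattern. -/
def solver : Prog :=
  .ite (.reg 1) (.seq prepare (.seq assignPairs (.seq assignRest (.assign 0 (Expr.not (.reg 17))))))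
    (.assign 0 (Expr.not (.reg 0)))

/-- Every non-constant monomial contains `n` and divides n³d², so for `0 < d` it is at most n³d²,
also when `n = 0`. The coefficients sum to less than 2000. -/
theorem solver_cost_le (n : ℕ) {d : ℕ} (hd : 0 < d) :
    n * 15 + n * d * 15 + 12 + (n * (n * (2 * (d * (n * (d * 108 + 14) + 20) + 6) +
      (d * (d * 308 + 14) + 6) + 8) + 14) + 6) +
      (n * (n * (d * (n * 228 + 150) + 20) + 70) + 6) + 10
      ≤ 2000 * (n ^ 3 * d ^ 2 + 1) := by
  have mono : ∀ i j, 1 ≤ i → i ≤ 3 → j ≤ 2 → n ^ i * d ^ j ≤ n ^ 3 * d ^ 2 := by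
    intro i j h1 hi hj
    rcases (Nat.eq_zero_or_pos n).symm with hn | rfl
    · exact Nat.mul_le_mul (Nat.pow_le_pow_right hn hi) (Nat.pow_le_pow_right hd hj)
    · rw [zero_pow (by omega), Nat.zero_mul]; exact Nat.zero_le _
  have h10 := mono 1 0 (by omega) (by omega) (by omega)
  have h11 := mono 1 1 (by omega) (by omega) (by omega)
  have h20 := mono 2 0 (by omega) (by omega) (by omega)
  have h21 := mono 2 1 (by omega) (by omega) (by omega)
  have h22 := mono 2 2 (by omega) (by omega) (by omega)
  have h31 := mono 3 1 (by omega) (by omega) (by omega)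
  ring_nf at h10 h11 h20 h21 h22 h31 ⊢
  omega

theorem solver_spec (P : CSPPattern (Fin n) (Fin d)) (h : P.NegtransFree) :
    Runs solver (input P) (2000 * (n ^ 3 * d ^ 2 + 1)) (Answers P) := by
  have i0 : (input P).reg 0 = n := rfl
  have i1 : (input P).reg 1 = d := rfl
  -- For `d = 0` the time bound is a constant and leaves no room for a loop over the variables; an
  -- instance is then solvable iff `n = 0`.
  rcases Nat.eq_zero_or_pos d with hd | hd
  · refine Runs.ite 4 (fun hc => absurd (i1.trans hd) hc) (fun _ => ?_) (by
      simp only [Expr.cost]; omega)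
    refine Runs.straight rfl (by decide) ?_
    simp only [Prog.run, Expr.not, Expr.val, i0, Answers, Mem.setReg_reg, if_true, Mem.setReg_arr]
    subst hd
    rcases Nat.eq_zero_or_pos n with rfl | hn
    · refine Or.inl ⟨rfl, fun v => v.elim0, ?_, fun v => v.elim0⟩
      rw [CSPPattern.isSolution_iff h.1.known h.1.binary]
      exact ⟨fun v => v.elim0, fun v => v.elim0⟩
    · exact Or.inr ⟨by omega, fun ⟨s, _⟩ => (s ⟨0, hn⟩).elim0⟩
  · have hcost := solver_cost_le n hd
    refine Runs.ite (2000 * (n ^ 3 * d ^ 2 + 1) - 2) (fun _ => ?_)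
      (fun hc => absurd (i1.symm.trans hc) hd.ne') (by simp only [Expr.cost]; omega)
    refine Runs.seq _ ((n * (n * (2 * (d * (n * (d * 108 + 14) + 20) + 6) +
        (d * (d * 308 + 14) + 6) + 8) + 14) + 6) +
        ((n * (n * (d * (n * 228 + 150) + 20) + 70) + 6) + 8))
      ((prepare_runs i0 i1 rfl rfl).mono le_rfl ?_) (by omega)
    rintro m₁ hf₁ ⟨a3, a4⟩ -
    have hE₁ := encoded_of_input h ((hf₁.reg 0 notMem_of_decide).trans i0)
      ((hf₁.reg 1 notMem_of_decide).trans i1) (hf₁.arr 0 notMem_of_decide)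
      (hf₁.arr 1 notMem_of_decide) a3 a4
    have izero : ∀ k, 2 ≤ k → (input P).arr k = fun _ => 0 := by
      intro k hk
      funext i
      have e0 : k ≠ 0 := by omega
      have e1 : k ≠ 1 := by omega
      simp [input, e0, e1]
    refine Runs.seq _ _ ((assignPairs_runs hE₁
      ((hf₁.arr 5 notMem_of_decide).trans (izero 5 (by omega)))).mono le_rfl ?_) le_rfl
    rintro m₂ hf₂ hI₂ -
    have hE₂ := hE₁.frame hf₂
    have z : ∀ k, k ∉ prepare.arrs → k ∉ assignPairs.arrs → 2 ≤ k → m₂.arr k = fun _ => 0 :=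
      fun k hk hk' h2 => (hf₂.arr k hk').trans ((hf₁.arr k hk).trans (izero k h2))
    have h17₂ : m₂.reg 17 = 0 :=
      (hf₂.reg 17 notMem_of_decide).trans (hf₁.reg 17 notMem_of_decide)
    -- The core consists of the variables left unassigned by the greedy phase; `Closed` says that
    -- the values assigned so far have no neighbours in it.
    have hX : (netOf P h).Extended (fun v => m₂.arr 5 v = 0) 0 m₂ := by
      refine ⟨⟨hI₂.valid, fun v hv => hv, fun v hv u c hu hadj => hI₂.closed v hv u c hadj hu⟩,
        by simp, ?_, ?_, ?_⟩
      · simp [z 7 notMem_of_decide notMem_of_decide (by omega)]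
      · simp [z 9 notMem_of_decide notMem_of_decide (by omega)]
      · simp [z 10 notMem_of_decide notMem_of_decide (by omega)]
    refine Runs.seq _ _ ((assignRest_runs hE₂ (fun hv hw => hI₂.quad hv hw) hX h17₂).mono le_rfl ?_)
      le_rfl
    intro m₃ _ hQ _
    refine Runs.straight rfl (by decide) ?_
    simp only [Prog.run, Expr.not, Expr.val, Answers, Mem.setReg_reg, if_true, Mem.setReg_arr]
    rcases hQ with ⟨h17, hsol⟩ | ⟨h17, hno⟩
    · have hlt : ∀ v : Fin n, m₃.arr 2 v.1 < d := fun v =>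
        ((netOf P h).perm_lt (hsol.1 v.1 v.2)).2
      exact Or.inl ⟨by omega, fun v => ⟨m₃.arr 2 v.1, hlt v⟩,
        (netOf_solves_iff h fun v => rfl).1 hsol, fun v => rfl⟩
    · refine Or.inr ⟨by omega, fun ⟨s, hs⟩ =>
        hno (fun v => if hv : v < n then (s ⟨v, hv⟩).1 else 0) ?_⟩
      exact (netOf_solves_iff h fun v => by simp).2 hs

end RAM

theorem mainTheorem6 :
    (∀ (V D : Type*) [Finite V] [Finite D] (P : CSPPattern V D), P.NegtransFree →
      (∀ H : P.Component, CSPPattern.IsInconsistencyClique H ∨ (CSPPattern.vars H).ncard = 2) ∧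
      (∃ M, P.IsRemovalFamily M) ∧
      ∀ M, P.IsRemovalFamily M → ∀ P₁, P₁ = P.restrict (P.remaining M) →
        ∀ P₂, P₂ = CSPPattern.allDifferentUnary P₁.componentsAt →
          (∃ f, P.IsRemovalAssignment M f) ∧
          (∀ f, P.IsRemovalAssignment M f → ∀ s : V → D, (∀ v, s v.1 = f v) →
            (P.IsSolution s ↔ P₁.IsSolution fun v => s v.1)) ∧
          (∀ s, P.IsSolution s → P₁.IsSolution fun v => s v.1) ∧
          (∀ H : P₁.Component, CSPPattern.IsInconsistencyClique H) ∧
          (∀ s s', P₁.Corresponds s s' → (P₁.IsSolution s ↔ P₂.IsSolution s')) ∧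
          (∀ s, P₁.IsSolution s → ∃ s', P₁.Corresponds s s') ∧
          (∀ s', P₂.IsSolution s' → ∃ s, P₁.Corresponds s s') ∧
          (P.Solvable ↔ P₂.Solvable) ∧
          (P₂.Solvable ↔ ∃ N : (CSPPattern.valueGraph P₁.componentsAt).Subgraph,
            N.IsMatching ∧ ∀ v, Sum.inl v ∈ N.verts)) ∧
    ∃ (prog : RAM.Prog) (c : ℕ), ∀ (n d : ℕ) (P : CSPPattern (Fin n) (Fin d)), P.NegtransFree →
      ∃ (t : ℕ) (m : RAM.Mem), RAM.Exec prog (RAM.input P) t m ∧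
        t ≤ c * (n ^ 3 * d ^ 2 + 1) ∧ RAM.Answers P m := by
  refine ⟨fun V D _ _ P h => ⟨CSPPattern.clique_or_ncard_vars h, CSPPattern.exists_removalFamily P,
    ?_⟩, RAM.solver, 2000, fun n d P h => RAM.solver_spec P h⟩
  rintro M hM _ rfl _ rfl
  have hk := CSPPattern.restrict_known h.1 (P.remaining M)
  have hb := CSPPattern.restrict_binary h.1 (P.remaining M)
  exact ⟨hM.exists_assignment h, fun f hf s hs => hf.isSolution_iff h hM hs,
    fun s hs => CSPPattern.isSolution_restrict h.1 hs _, hM.isInconsistencyClique h,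
    fun s s' hs => hs.isSolution_iff hk hb (hM.isInconsistencyClique h),
    fun s hs => hs.exists_corresponds hk hb,
    fun s' hs' => CSPPattern.exists_corresponds_of_isSolution hs', hM.solvable_iff h,
    CSPPattern.allDifferentUnary_solvable_iff⟩
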